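/- **Conway sphere and simple loops.** Let $S$ be the quotient of $\mathbb R^2\setminus\mathbb Z^2$ by the group generated by the $\pi$-rotations $x\mapsto 2v-x$ about the points $v\in\mathbb Z^2$ (a 4-times punctured sphere). For $s\in\hat{\mathbb Q}:=\mathbb Q\cup\{\infty\}$ let $\alpha_s$ be the simple loop in $S$ obtained as the projection of a line of slope $s$ in $\mathbb R^2\setminus\mathbb Z^2$. It is an unoriented loop; it determines a conjugacy class, up to inversion, in $\pi_1(S)$ and in every quotient of $\pi_1(S)$. **Even Heckoid group.** For an integer $n\ge 2$ let $$\mathrm{Hecke}(0;n)=\pi_1(S)/\langle\langle \alpha_\infty,\ \alpha_0^{\,n}\rangle\rangle .$$ **The group $\Gamma(0;n)$.** Let $\Gamma(0;n)$ be the group of automorphisms of the Farey tessellation generated by the reflections $x\mapsto 2k-x$ $(k\in\mathbb Z)$ in the Farey edges $\langle\infty,k\rangle$ with an endpoint $\infty$, and the parabolic transformation $x\mapsto x/(2nx+1)$, which is centered on the vertex $0$ and shifts by $2n$ units in the clockwise direction. It acts on the set $\hat{\mathbb Q}$ of vertices of the tessellation. **Theorem.** Let $n\ge 2$ be an integer.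 For every $s\in\hat{\mathbb Q}$ there is a unique $s_0\in\big([1/n,1]\cap\mathbb Q\big)\cup\{\infty,0\}$ such that $s$ lies in the $\Gamma(0;n)$-orbit of $s_0$. Moreover, the loops $\alpha_s$ and $\alpha_{s_0}$ determine the same conjugacy class (up to inversion, since the loops are unoriented) in $\mathrm{Hecke}(0;n)$. In particular: 1. if $s_0=\infty$, then $\alpha_s$ represents the trivial conjugacy class of $\mathrm{Hecke}(0;n)$; 2. if $s_0=0$, then $\alpha_s$ is torsion in $\mathrm{Hecke}(0;n)$, i.e. it represents the conjugacy class of a non-trivial element of finite order. -/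

import Mathlib

noncomputable section

namespace Heckoid

/-! ### The Conway sphere -/

/-- The punctured plane `ℝ² - ℤ²`. -/
abbrev PuncturedPlane : Type :=
  {p : ℝ × ℝ // ∀ v : ℤ × ℤ, p ≠ ((v.1 : ℝ), (v.2 : ℝ))}

/-- The `π`-rotation `p ↦ 2v - p` of `ℝ² - ℤ²` about the lattice point `v`. -/
def halfTurn (v : ℤ × ℤ) : Equiv.Perm PuncturedPlane :=
  Function.Involutive.toPerm
    (fun p => ⟨(2 * (v.1 : ℝ) - p.1.1, 2 * (v.2 : ℝ) - p.1.2), fun w h =>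
      p.2 (2 * v.1 - w.1, 2 * v.2 - w.2) (by
        have h1 := congrArg Prod.fst h
        have h2 := congrArg Prod.snd h
        simp only at h1 h2
        ext
        · push_cast
          linarith
        · push_cast
          linarith)⟩)
    (fun p => by
      apply Subtype.ext
      ext <;> simp)

theorem halfTurn_apply (v : ℤ × ℤ) (p : PuncturedPlane) :
    (halfTurn v p).1 = (2 * (v.1 : ℝ) - p.1.1, 2 * (v.2 : ℝ) - p.1.2) := rfl

/-- The group generated by the `π`-rotations about the points of `ℤ²`. -/
def halfTurnGroup : Subgroup (Equiv.Perm PuncturedPlane) :=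
  Subgroup.closure (Set.range halfTurn)

/-- The Conway sphere: the quotient of `ℝ² - ℤ²` by the group generated by the `π`-rotations
about the points of `ℤ²`, with the quotient topology. -/
abbrev ConwaySphere : Type :=
  MulAction.orbitRel.Quotient halfTurnGroup PuncturedPlane

/-- The projection of `ℝ² - ℤ²` onto the Conway sphere. -/
def proj (p : PuncturedPlane) : ConwaySphere := Quotient.mk'' p

theorem continuous_proj : Continuous proj := continuous_quotient_mk'

/-! ### The simple loops `α_s` -/

/-- The primitive integral direction vector of a line of slope `s ∈ ℚ ∪ {∞}`:
`(0, 1)` for `s = ∞`, and `(b, a)` for `s = a / b` in lowest terms with `b > 0`. -/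
def direction (s : OnePoint ℚ) : ℤ × ℤ :=
  s.elim (0, 1) (fun q => ((q.den : ℤ), q.num))

/-- The point `p + t • direction s` of the line of slope `s` through `p`. -/
def linePoint (s : OnePoint ℚ) (p : ℝ × ℝ) (t : ℝ) : ℝ × ℝ :=
  (p.1 + t * ((direction s).1 : ℝ), p.2 + t * ((direction s).2 : ℝ))

/-- The line of slope `s` through `p` lies in `ℝ² - ℤ²`. -/
def LineAvoidsLattice (s : OnePoint ℚ) (p : ℝ × ℝ) : Prop :=
  ∀ (t : ℝ) (v : ℤ × ℤ), linePoint s p t ≠ ((v.1 : ℝ), (v.2 : ℝ))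

/-- The line of slope `s` through `p`, as a map to `ℝ² - ℤ²`. -/
def line (s : OnePoint ℚ) (p : ℝ × ℝ) (h : LineAvoidsLattice s p) (t : ℝ) : PuncturedPlane :=
  ⟨linePoint s p t, h t⟩

theorem continuous_line (s : OnePoint ℚ) (p : ℝ × ℝ) (h : LineAvoidsLattice s p) :
    Continuous (line s p h) := by
  unfold line linePoint
  fun_prop

theorem proj_line_add_two (s : OnePoint ℚ) (p : ℝ × ℝ) (h : LineAvoidsLattice s p) (t : ℝ) :
    proj (line s p h (t + 2)) = proj (line s p h t) := by
  apply Quotient.sound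
  refine ⟨⟨halfTurn (direction s) * halfTurn 0,
    mul_mem (Subgroup.subset_closure ⟨_, rfl⟩) (Subgroup.subset_closure ⟨_, rfl⟩)⟩, ?_⟩
  apply Subtype.ext
  change (halfTurn (direction s) (halfTurn 0 (line s p h t))).1 = linePoint s p (t + 2)
  rw [halfTurn_apply, halfTurn_apply]
  simp only [line, linePoint, Prod.fst_zero, Prod.snd_zero, Int.cast_zero]
  ext <;> simp only <;> ring

/-- The simple loop `α_s` in the Conway sphere: the projection of a line of slope `s` in
`ℝ² - ℤ²`. Such a line is invariant under exactly the translations by the multiples of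
`2 • direction s` in the group, so the segment `0 ≤ t ≤ 2` runs once around its image. -/
def slopeLoop (s : OnePoint ℚ) (p : ℝ × ℝ) (h : LineAvoidsLattice s p) :
    Path (proj (line s p h 0)) (proj (line s p h 0)) where
  toFun t := proj (line s p h (2 * (t : ℝ)))
  continuous_toFun :=
    continuous_proj.comp ((continuous_line s p h).comp (by fun_prop))
  source' := by simp
  target' := by simpa using proj_line_add_two s p h 0

/-- The elements of `π₁(ConwaySphere, x₀)` represented by the unoriented loop `α_s`: the classes
of `γ · α_s · γ⁻¹` and their inverses, where `γ` is a path from `x₀` to a point of `α_s`. -/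
def slopeClass (x₀ : ConwaySphere) (s : OnePoint ℚ) : Set (FundamentalGroup ConwaySphere x₀) :=
  {g | ∃ (p : ℝ × ℝ) (h : LineAvoidsLattice s p) (γ : Path x₀ (proj (line s p h 0))),
    g = FundamentalGroup.fromPath
        (Path.Homotopic.Quotient.mk ((γ.trans (slopeLoop s p h)).trans γ.symm)) ∨
    g = (FundamentalGroup.fromPath
        (Path.Homotopic.Quotient.mk ((γ.trans (slopeLoop s p h)).trans γ.symm)))⁻¹}

/-! ### The even Heckoid group -/

/-- The normal closure of `α_∞` and `α_r ^ n` in `π₁(ConwaySphere, x₀)`. -/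
def relators (r : ℚ) (n : ℕ) (x₀ : ConwaySphere) :
    Subgroup (FundamentalGroup ConwaySphere x₀) :=
  Subgroup.normalClosure
    (slopeClass x₀ OnePoint.infty ∪ (fun g => g ^ n) '' slopeClass x₀ (r : OnePoint ℚ))

instance (r : ℚ) (n : ℕ) (x₀ : ConwaySphere) : (relators r n x₀).Normal :=
  Subgroup.normalClosure_normal

/-- The even Heckoid group `π₁(ConwaySphere) / ⟨⟨α_∞, α_r ^ n⟩⟩`. -/
abbrev Hecke (r : ℚ) (n : ℕ) (x₀ : ConwaySphere) : Type :=
  FundamentalGroup ConwaySphere x₀ ⧸ relators r n x₀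

/-- The elements of the Heckoid group represented by the unoriented loop `α_s`. -/
def heckeClass (r : ℚ) (n : ℕ) (x₀ : ConwaySphere) (s : OnePoint ℚ) : Set (Hecke r n x₀) :=
  QuotientGroup.mk' (relators r n x₀) '' slopeClass x₀ s

/-- The conjugacy class of `g` up to inversion, i.e. the conjugacy class determined by an
unoriented loop representing `g`. -/
def unorientedConjClass {G : Type*} [Group G] (g : G) : Set G :=
  {h | IsConj g h ∨ IsConj g⁻¹ h}

/-! ### The group `Γ(0; n)` acting on `ℚ ∪ {∞}` -/

/-- The reflection in the Farey edge `⟨∞, k⟩`, acting on `ℚ ∪ {∞}` by `x ↦ 2k - x`. -/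
def reflection (k : ℤ) : GL (Fin 2) ℚ :=
  Matrix.GeneralLinearGroup.mkOfDetNeZero !![-1, 2 * (k : ℚ); 0, 1]
    (by simp [Matrix.det_fin_two])

/-- The parabolic transformation `x ↦ x / (m x + 1)` centered on the vertex `0` of the Farey
tessellation, shifting the Farey triangles around `0` by `m` units in the clockwise direction:
it sends the Farey edge `⟨0, 1 / k⟩` to `⟨0, 1 / (k + m)⟩`. -/
def parabolicZero (m : ℤ) : GL (Fin 2) ℚ :=
  Matrix.GeneralLinearGroup.mkOfDetNeZero !![1, 0; (m : ℚ), 1]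
    (by simp [Matrix.det_fin_two])

/-- The group `Γ(0; n)`, generated by the reflections in the Farey edges with an endpoint `∞` and
by the parabolic transformation centered on `0` by `2n` units. -/
def Gam (n : ℕ) : Subgroup (GL (Fin 2) ℚ) :=
  Subgroup.closure (Set.range reflection ∪ {parabolicZero (2 * n)})

/-- The set of slopes `([1/n, 1] ∩ ℚ) ∪ {∞, 0}`. -/
def fundamentalSlopes (n : ℕ) : Set (OnePoint ℚ) :=
  ((↑) : ℚ → OnePoint ℚ) '' Set.Icc (1 / (n : ℚ)) 1 ∪ {OnePoint.infty, ((0 : ℚ) : OnePoint ℚ)}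

end Heckoid

end

/-!
Orbits. The group `Γ(0; n)` is generated by the reflections in the Farey edges `⟨∞, 0⟩`, `⟨∞, 1⟩`
and `⟨0, 1 / n⟩`, which bound a domain whose trace on `ℚ ∪ {∞}` is the set of fundamental slopes.
Every slope is moved there by a Euclidean algorithm (`exists_fundamental`), and two fundamental
slopes in one orbit agree by ping-pong for the three reflections (`eq_of_mem_orbit`).

Equal classes. A quotient of the fundamental group is handled through the transports of straight
segments in the punctured plane (`IsTransport`): elements of the quotient that compose inside
convex sets free of lattice points and are invariant under the half-turns. The transport of `α_s`
is that of a segment of slope `s`, and `transportClass_eq` shows that all such segments give one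
class up to inversion. Suppose that `r` turns along the vertical loop are trivial. Two lines
`y = f x` and `y = f' x` can be joined by vertical connectors, off the lines `x = m`, and these
connectors intertwine the transports of the two lines as soon as for each integer `m` the intervals
between consecutive integers that contain `f m` and `f' m` are congruent modulo `2 r`
(`IsTransport.isConj_of_gates`). With `r = 1` and `f' x = 1 - f x + 2 k x`, this identifies the
classes of `s` and `2 k - s` when `α_∞` is trivial; with the coordinates exchanged, `r = n` and
`f' x = f x + 2 n x`, it identifies those of `s` and `s / (2 n s + 1)` when `α_0 ^ n` is trivial.

Torsion. The class of `α_0` has order dividing `n` by definition. It is not trivial because the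
explicit nowhere vanishing function `windingFun` on the Conway sphere has winding number `0` along
`α_∞` and `±1` along `α_0`, so that all relators have winding number divisible by `n ≥ 2`.
-/

noncomputable section

namespace Heckoid

/-! ### Orbits of slopes -/

theorem reflection_smul_coe (k : ℤ) (x : ℚ) :
    reflection k • (x : OnePoint ℚ) = ((2 * k - x : ℚ) : OnePoint ℚ) := by
  rw [OnePoint.smul_some_eq_ite]
  simp [reflection, Matrix.GeneralLinearGroup.mkOfDetNeZero]
  ring

theorem reflection_smul_infty (k : ℤ) :
    reflection k • (OnePoint.infty : OnePoint ℚ) = OnePoint.infty := by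
  rw [OnePoint.smul_infty_eq_ite]
  simp [reflection, Matrix.GeneralLinearGroup.mkOfDetNeZero]

theorem parabolicZero_smul_coe (m : ℤ) (x : ℚ) :
    parabolicZero m • (x : OnePoint ℚ) =
      if m * x + 1 = 0 then OnePoint.infty else ((x / (m * x + 1) : ℚ) : OnePoint ℚ) := by
  rw [OnePoint.smul_some_eq_ite]
  simp [parabolicZero, Matrix.GeneralLinearGroup.mkOfDetNeZero]

theorem parabolicZero_smul_infty (m : ℤ) :
    parabolicZero m • (OnePoint.infty : OnePoint ℚ) =
      if (m : ℚ) = 0 then OnePoint.infty else ((1 / m : ℚ) : OnePoint ℚ) := by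
  rw [OnePoint.smul_infty_eq_ite]
  simp [parabolicZero, Matrix.GeneralLinearGroup.mkOfDetNeZero]

theorem parabolicZero_mul (a b : ℤ) :
    parabolicZero a * parabolicZero b = parabolicZero (a + b) := by
  ext i j
  fin_cases i <;> fin_cases j <;>
    simp [parabolicZero, Matrix.GeneralLinearGroup.mkOfDetNeZero]

theorem reflection_mul_mul (i j k : ℤ) :
    reflection i * reflection j * reflection k = reflection (i - j + k) := by
  ext a b
  fin_cases a <;> fin_cases b <;>
    simp [reflection, Matrix.GeneralLinearGroup.mkOfDetNeZero]
  ring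

theorem reflection_mul_self (k : ℤ) : reflection k * reflection k = 1 := by
  ext a b
  fin_cases a <;> fin_cases b <;>
    simp [reflection, Matrix.GeneralLinearGroup.mkOfDetNeZero]

theorem reflection_mem (n : ℕ) (k : ℤ) : reflection k ∈ Gam n :=
  Subgroup.subset_closure (Or.inl ⟨k, rfl⟩)

theorem parabolicZero_mem (n : ℕ) (j : ℤ) : parabolicZero (2 * n * j) ∈ Gam n := by
  have h : parabolicZero (2 * n) ∈ Gam n := Subgroup.subset_closure (Or.inr rfl)
  have h0 : parabolicZero 0 = 1 := by
    have := parabolicZero_mul 0 0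
    simpa using this
  induction j using Int.induction_on with
  | zero => rw [mul_zero, h0]; exact one_mem _
  | succ i ih =>
    rw [mul_add, mul_one, ← parabolicZero_mul]
    exact mul_mem ih h
  | pred i ih =>
    rw [← Subgroup.mul_mem_cancel_right _ h, parabolicZero_mul]
    convert ih using 2
    ring

/-- The reflections in the three Farey edges `⟨∞, 0⟩`, `⟨∞, 1⟩` and `⟨0, 1 / n⟩` that bound the
fundamental domain of `Γ(0; n)`. -/
def wallReflection (n : ℕ) : Fin 3 → GL (Fin 2) ℚ :=
  ![reflection 0, reflection 1, parabolicZero (2 * n) * reflection 0]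

/-- The slopes beyond the `i`-th wall of the fundamental domain. -/
def beyond (n : ℕ) : Fin 3 → Set ℚ :=
  ![Set.Iio 0, Set.Ioi 1, Set.Ioo 0 (1 / (n : ℚ))]

theorem wallReflection_mul_self (n : ℕ) (i : Fin 3) :
    wallReflection n i * wallReflection n i = 1 := by
  fin_cases i
  · exact reflection_mul_self 0
  · exact reflection_mul_self 1
  · ext a b
    fin_cases a <;> fin_cases b <;>
    simp [wallReflection, parabolicZero, reflection, Matrix.GeneralLinearGroup.mkOfDetNeZero]

theorem gam_le_closure_wallReflection (n : ℕ) :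
    Gam n ≤ Subgroup.closure (Set.range (wallReflection n)) := by
  have hw (i) : wallReflection n i ∈ Subgroup.closure (Set.range (wallReflection n)) :=
    Subgroup.subset_closure ⟨i, rfl⟩
  have h0 : reflection 0 ∈ _ := hw 0
  have h1 : reflection 1 ∈ _ := hw 1
  have h2 : parabolicZero (2 * n) * reflection 0 ∈ _ := hw 2
  unfold Gam
  rw [Subgroup.closure_le]
  rintro g (⟨k, rfl⟩ | rfl)
  · induction k using Int.induction_on with
    | zero => exact h0
    | succ i ih =>
      have := mul_mem (mul_mem h1 h0) ih
      rw [reflection_mul_mul, show (1 - 0 + i : ℤ) = i + 1 by ring] at this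
      exact this
    | pred i ih =>
      have := mul_mem (mul_mem h0 h1) ih
      rw [reflection_mul_mul, show (0 - 1 + -i : ℤ) = -i - 1 by ring] at this
      exact this
  · exact (Subgroup.mul_mem_cancel_right _ h0).1 h2

theorem wall_two_smul_coe (n : ℕ) {x : ℚ} (hx : 2 * n * x - 1 ≠ 0) :
    (parabolicZero (2 * n) * reflection 0) • (x : OnePoint ℚ) =
      ((x / (2 * n * x - 1) : ℚ) : OnePoint ℚ) := by
  rw [mul_smul, reflection_smul_coe, parabolicZero_smul_coe, if_neg]
  · congr 1
    push_cast
    rw [← neg_div_neg_eq]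
    congr 1 <;> ring
  · push_cast
    intro h
    apply hx
    linarith

theorem wallReflection_smul_beyond {n : ℕ} (hn : 2 ≤ n) {i j : Fin 3} (hij : j ≠ i) {x : ℚ}
    (hx : x ∈ beyond n j) :
    wallReflection n i • (x : OnePoint ℚ) ∈ ((↑) : ℚ → OnePoint ℚ) '' beyond n i := by
  have hn' : (2 : ℚ) ≤ n := by exact_mod_cast hn
  have hn1 : 1 / (n : ℚ) < 1 := by
    rw [div_lt_one (by linarith)]
    linarith
  fin_cases i <;> fin_cases j <;> simp [wallReflection, beyond] at hij hx ⊢ <;>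
    try simp only [reflection_smul_coe, OnePoint.coe_eq_coe, exists_eq_right]
  · push_cast; linarith
  · push_cast; linarith
  · push_cast; linarith
  · push_cast; simp at hn1; linarith
  · have hd : 2 * n * x - 1 < 0 := by nlinarith
    refine ⟨_, ?_, (wall_two_smul_coe n hd.ne).symm⟩
    refine ⟨div_pos_of_neg_of_neg hx hd, ?_⟩
    rw [div_lt_iff_of_neg hd, inv_mul_lt_iff₀ (by linarith)]
    nlinarith
  · have hd : 0 < 2 * n * x - 1 := by nlinarith
    refine ⟨_, ?_, (wall_two_smul_coe n hd.ne').symm⟩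
    refine ⟨by positivity, ?_⟩
    rw [div_lt_iff₀ hd, lt_inv_mul_iff₀ (by linarith)]
    nlinarith

theorem wallReflection_smul_fundamental {n : ℕ} (hn : 2 ≤ n) (i : Fin 3) {s : OnePoint ℚ}
    (hs : s ∈ fundamentalSlopes n) :
    wallReflection n i • s = s ∨
      wallReflection n i • s ∈ ((↑) : ℚ → OnePoint ℚ) '' beyond n i := by
  have hn' : (2 : ℚ) ≤ n := by exact_mod_cast hn
  obtain ⟨x, ⟨hx1, hx2⟩, rfl⟩ | rfl | rfl := hs
  · have hx0 : 0 < x := lt_of_lt_of_le (by positivity) hx1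
    rw [div_le_iff₀ (by linarith)] at hx1
    fin_cases i <;> simp [wallReflection, beyond] <;>
      try simp only [reflection_smul_coe, OnePoint.coe_eq_coe, exists_eq_right]
    · right; push_cast; linarith
    · rcases hx2.eq_or_lt with rfl | h
      · left; norm_num
      · right; push_cast; linarith
    · have hd : 0 < 2 * n * x - 1 := by nlinarith
      rw [wall_two_smul_coe n hd.ne']
      simp only [OnePoint.coe_eq_coe, exists_eq_right]
      rcases hx1.eq_or_lt with h | h
      · left
        rw [div_eq_iff hd.ne']
        nlinarith
      · right
        refine ⟨by positivity, ?_⟩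
        rw [div_lt_iff₀ hd, lt_inv_mul_iff₀ (by linarith)]
        nlinarith
  · fin_cases i <;> simp [wallReflection, beyond, reflection_smul_infty]
    right
    rw [mul_smul, reflection_smul_infty, parabolicZero_smul_infty,
      if_neg (by push_cast; positivity)]
    refine ⟨_, ⟨?_, ?_⟩, rfl⟩
    · push_cast; positivity
    · push_cast
      rw [one_div]
      exact inv_strictAnti₀ (by linarith) (by linarith)
  · fin_cases i <;> simp only [wallReflection, beyond, Fin.zero_eta, Fin.mk_one, Fin.reduceFinMk,
      Matrix.cons_val, reflection_smul_coe]
    · left; norm_num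
    · right; exact ⟨_, by norm_num, rfl⟩
    · left
      rw [wall_two_smul_coe n (by norm_num)]
      norm_num

/-- `Reached n s i t`: the slope `t` arises from `s` by a reduced word in the wall reflections
whose last applied letter is `i` (`none` for the empty word). -/
inductive Reached (n : ℕ) (s : OnePoint ℚ) : Option (Fin 3) → OnePoint ℚ → Prop
  | base : Reached n s none s
  | step {o : Option (Fin 3)} {t : OnePoint ℚ} (i : Fin 3) (h : Reached n s o t)
      (ho : o ≠ some i) : Reached n s (some i) (wallReflection n i • t)

theorem Reached.smul {n : ℕ} {s t : OnePoint ℚ} {o : Option (Fin 3)} (h : Reached n s o t)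
    (i : Fin 3) : ∃ o', Reached n s o' (wallReflection n i • t) := by
  by_cases ho : o = some i
  · subst ho
    obtain _ | ⟨_, h', _⟩ := h
    rw [smul_smul, wallReflection_mul_self, one_smul]
    exact ⟨_, h'⟩
  · exact ⟨_, h.step i ho⟩

theorem exists_reached {n : ℕ} {s t : OnePoint ℚ} (h : t ∈ MulAction.orbit (Gam n) s) :
    ∃ o, Reached n s o t := by
  obtain ⟨⟨g, hg⟩, rfl⟩ := h
  change ∃ o, Reached n s o (g • s)
  suffices H : ∀ g ∈ Subgroup.closure (Set.range (wallReflection n)), ∀ t,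
      (∃ o, Reached n s o t) → ∃ o, Reached n s o (g • t) from
    H g (gam_le_closure_wallReflection n hg) s ⟨_, .base⟩
  intro g hg
  induction hg using Subgroup.closure_induction'' with
  | one => intro t h; rwa [one_smul]
  | mem g hg =>
    obtain ⟨i, rfl⟩ := hg
    rintro t ⟨o, h⟩
    exact h.smul i
  | inv_mem g hg =>
    obtain ⟨i, rfl⟩ := hg
    rw [inv_eq_of_mul_eq_one_left (wallReflection_mul_self n i)]
    rintro t ⟨o, h⟩
    exact h.smul i
  | mul g g' _ _ hg hg' =>
    intro t h
    rw [mul_smul]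
    exact hg _ (hg' _ h)

/-- The ping-pong argument: a reduced word moves a fundamental slope beyond the wall of its last
letter, or fixes it. -/
theorem Reached.eq_or_beyond {n : ℕ} (hn : 2 ≤ n) {s t : OnePoint ℚ}
    (hs : s ∈ fundamentalSlopes n) {o : Option (Fin 3)} (h : Reached n s o t) :
    t = s ∨ ∃ i, o = some i ∧ t ∈ ((↑) : ℚ → OnePoint ℚ) '' beyond n i := by
  induction h with
  | base => exact Or.inl rfl
  | step i h ho ih =>
    obtain rfl | ⟨j, rfl, x, hx, rfl⟩ := ih
    · exact (wallReflection_smul_fundamental hn i hs).imp id fun h => ⟨i, rfl, h⟩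
    · exact Or.inr ⟨i, rfl, wallReflection_smul_beyond hn (fun h => ho (by rw [h])) hx⟩

theorem not_mem_fundamentalSlopes_of_beyond {n : ℕ} (hn : 2 ≤ n) (i : Fin 3) {x : ℚ}
    (hx : x ∈ beyond n i) : (x : OnePoint ℚ) ∉ fundamentalSlopes n := by
  have hn' : 0 < 1 / (n : ℚ) := by positivity
  rintro (⟨y, ⟨h1, h2⟩, h⟩ | h | h)
  · rw [OnePoint.coe_eq_coe] at h
    subst h
    fin_cases i
    · exact absurd (hn'.trans_le h1) (not_lt.2 (le_of_lt hx))
    · exact absurd hx (not_lt.2 h2)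
    · exact absurd hx.2 (not_lt.2 h1)
  · exact OnePoint.coe_ne_infty x h
  · rw [Set.mem_singleton_iff, OnePoint.coe_eq_coe] at h
    subst h
    fin_cases i <;> simp [beyond] at hx
    linarith

/-- No two fundamental slopes lie in one orbit. -/
theorem eq_of_mem_orbit {n : ℕ} (hn : 2 ≤ n) {s t : OnePoint ℚ} (hs : s ∈ fundamentalSlopes n)
    (ht : t ∈ fundamentalSlopes n) (h : t ∈ MulAction.orbit (Gam n) s) : t = s := by
  obtain ⟨o, ho⟩ := exists_reached h
  obtain h | ⟨i, -, x, hx, rfl⟩ := ho.eq_or_beyond hn hs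
  · exact h
  · exact absurd ht (not_mem_fundamentalSlopes_of_beyond hn i hx)

/-- Division of `a` by the even multiple `2 b`, with remainder of least absolute value. -/
theorem exists_abs_sub_le (a : ℤ) {b : ℤ} (hb : b ≠ 0) : ∃ k : ℤ, |a - 2 * k * b| ≤ |b| := by
  refine ⟨round ((a : ℚ) / (2 * b)), ?_⟩
  have hb' : (b : ℚ) ≠ 0 := by exact_mod_cast hb
  have h := abs_sub_round ((a : ℚ) / (2 * b))
  have e : (a : ℚ) / (2 * b) - round ((a : ℚ) / (2 * b)) =
      (a - 2 * round ((a : ℚ) / (2 * b)) * b) / (2 * b) := by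
    field_simp
  rw [e, abs_div, abs_mul, div_le_iff₀ (by positivity)] at h
  have : |(a : ℚ) - 2 * round ((a : ℚ) / (2 * b)) * b| ≤ |(b : ℚ)| := by
    rw [abs_of_pos (by norm_num : (0 : ℚ) < 2)] at h
    linarith
  exact_mod_cast this

/-- The Euclidean algorithm: the denominator decreases until the slope is fundamental. -/
theorem exists_fundamental_of_ratio {n : ℕ} (hn : 2 ≤ n) (N : ℕ) (a b : ℤ) (hb : b ≠ 0)
    (hN : b.natAbs ≤ N) :
    ∃ s₀ ∈ fundamentalSlopes n, (((a : ℚ) / b : ℚ) : OnePoint ℚ) ∈ MulAction.orbit (Gam n) s₀ := by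
  have hn' : (2 : ℚ) ≤ n := by exact_mod_cast hn
  induction N generalizing a b with
  | zero => omega
  | succ N ih =>
    have transfer {s t : OnePoint ℚ} (g : GL (Fin 2) ℚ) (hg : g ∈ Gam n) (e : g • s = t)
        (h : ∃ s₀ ∈ fundamentalSlopes n, t ∈ MulAction.orbit (Gam n) s₀) :
        ∃ s₀ ∈ fundamentalSlopes n, s ∈ MulAction.orbit (Gam n) s₀ := by
      obtain ⟨s₀, h0, h1⟩ := h
      refine ⟨s₀, h0, ?_⟩
      rw [← e] at h1
      have := MulAction.mem_orbit_of_mem_orbit (⟨g, hg⟩⁻¹ : Gam n) h1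
      change g⁻¹ • g • s ∈ _ at this
      rwa [inv_smul_smul] at this
    have core (a : ℤ) (h0 : 0 ≤ (a : ℚ) / b) (h1 : (a : ℚ) / b ≤ 1) :
        ∃ s₀ ∈ fundamentalSlopes n,
          (((a : ℚ) / b : ℚ) : OnePoint ℚ) ∈ MulAction.orbit (Gam n) s₀ := by
      by_cases hF : (((a : ℚ) / b : ℚ) : OnePoint ℚ) ∈ fundamentalSlopes n
      · exact ⟨_, hF, MulAction.mem_orbit_self _⟩
      have hbq : (b : ℚ) ≠ 0 := by exact_mod_cast hb
      have ha : a ≠ 0 := by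
        rintro rfl
        exact hF (Or.inr (Or.inr (by simp)))
      have hlt : (a : ℚ) / b < 1 / n := by
        by_contra! h
        exact hF (Or.inl ⟨_, ⟨h, h1⟩, rfl⟩)
      have hab : |n * a| < |b| := by
        rw [lt_div_iff₀ (by linarith), ← abs_of_nonneg h0, abs_div, div_mul_eq_mul_div,
          div_lt_one (by positivity)] at hlt
        have : |(n : ℚ) * a| < |(b : ℚ)| := by
          rw [abs_mul, Nat.abs_cast]
          linarith
        exact_mod_cast this
      have hna : (n : ℤ) * a ≠ 0 := mul_ne_zero (by omega) ha
      -- a power of the parabolic element makes the denominator at most `n |a| < |b|`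
      obtain ⟨j, hj⟩ := exists_abs_sub_le b hna
      refine transfer (parabolicZero (2 * n * (-j))) (parabolicZero_mem n _) rfl ?_
      rw [parabolicZero_smul_coe]
      have hden : ((2 * n * (-j) : ℤ) : ℚ) * (a / b) + 1 = ((b - 2 * j * (n * a) : ℤ) : ℚ) / b := by
        push_cast
        field_simp
        ring
      split_ifs with hz
      · exact ⟨_, Or.inr (Or.inl rfl), MulAction.mem_orbit_self _⟩
      · rw [hden] at hz ⊢
        have hb' : b - 2 * j * (n * a) ≠ 0 := by
          intro h
          rw [h] at hz
          simp at hz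
        rw [div_div_div_cancel_right₀ hbq]
        have := hj.trans_lt hab
        rw [Int.abs_eq_natAbs, Int.abs_eq_natAbs] at this
        exact ih a _ hb' (by omega)
    obtain ⟨k, hk⟩ := exists_abs_sub_le a hb
    have hbq : (b : ℚ) ≠ 0 := by exact_mod_cast hb
    have hk' : |(a : ℚ) / b - 2 * k| ≤ 1 := by
      rw [show (a : ℚ) / b - 2 * k = (a - 2 * k * b) / b by field_simp, abs_div,
        div_le_one (by positivity)]
      exact_mod_cast hk
    rw [abs_le] at hk'
    refine transfer (reflection k) (reflection_mem n k) rfl ?_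
    rw [reflection_smul_coe]
    rcases le_total 0 (2 * k - (a : ℚ) / b) with h | h
    · have e : 2 * k - (a : ℚ) / b = (2 * k * b - a : ℤ) / b := by push_cast; field_simp
      rw [e] at h ⊢
      exact core _ h (by rw [← e]; linarith)
    · refine transfer (reflection 0) (reflection_mem n 0) rfl ?_
      rw [reflection_smul_coe]
      have e : 2 * (0 : ℤ) - (2 * k - (a : ℚ) / b) = (a - 2 * k * b : ℤ) / b := by
        push_cast; field_simp; ring
      rw [e]
      exact core _ (by rw [← e]; push_cast; linarith) (by rw [← e]; push_cast; linarith)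

theorem exists_fundamental {n : ℕ} (hn : 2 ≤ n) (s : OnePoint ℚ) :
    ∃ s₀ ∈ fundamentalSlopes n, s ∈ MulAction.orbit (Gam n) s₀ := by
  induction s using OnePoint.rec with
  | infty => exact ⟨_, Or.inr (Or.inl rfl), MulAction.mem_orbit_self _⟩
  | coe x =>
    rw [← Rat.num_div_den x]
    exact exists_fundamental_of_ratio hn _ x.num x.den (by simp) le_rfl

/-! ### Transport along straight segments -/

/-- The lattice `ℤ²` in the plane. -/
def lattice : Set (ℝ × ℝ) := Set.range fun v : ℤ × ℤ => ((v.1 : ℝ), (v.2 : ℝ))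

/-- A transport assigns to the straight segment from `p` to `q` an element of a group, in such a
way that it composes (in the order of functions) inside every convex set disjoint from the lattice
and is invariant under the half-turns about the lattice points. Its values on segments that meet
the lattice are irrelevant. -/
structure IsTransport {H : Type*} [Group H] (E : ℝ × ℝ → ℝ × ℝ → H) : Prop where
  mul_eq : ∀ (C : Set (ℝ × ℝ)) (p q r : ℝ × ℝ), Convex ℝ C → Disjoint C lattice →
    p ∈ C → q ∈ C → r ∈ C → E q r * E p q = E p r
  halfTurn_eq : ∀ (v : ℤ × ℤ) (p q : ℝ × ℝ),
    E (2 * v.1 - p.1, 2 * v.2 - p.2) (2 * v.1 - q.1, 2 * v.2 - q.2) = E p q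

/-- The end of the segment that starts at `p` and runs once around a loop of direction `d`. -/
def stepTwo (p : ℝ × ℝ) (d : ℤ × ℤ) : ℝ × ℝ := (p.1 + 2 * d.1, p.2 + 2 * d.2)

/-- The line through `p` in the direction `d` avoids the lattice. -/
def Avoids (d : ℤ × ℤ) (p : ℝ × ℝ) : Prop := ∀ t : ℝ, (p.1 + t * d.1, p.2 + t * d.2) ∉ lattice

/-- The elements of `H` that a transport assigns, up to conjugation and inversion, to the loop of
direction `d`. -/
def transportClass {H : Type*} [Group H] (E : ℝ × ℝ → ℝ × ℝ → H) (d : ℤ × ℤ) : Set H :=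
  {h | ∃ p, Avoids d p ∧ h ∈ unorientedConjClass (E p (stepTwo p d))}

/-! ### Convex sets disjoint from the lattice -/

theorem disjoint_lattice_iff {C : Set (ℝ × ℝ)} :
    Disjoint C lattice ↔ ∀ a b : ℤ, ((a : ℝ), (b : ℝ)) ∉ C := by
  rw [Set.disjoint_right]
  constructor
  · exact fun h a b => h ⟨(a, b), rfl⟩
  · rintro h _ ⟨v, rfl⟩
    exact h _ _

/-- The open strip of the points `p` with `m < a p.1 + b p.2 < m + 1`. -/
def openStrip (a b m : ℤ) : Set (ℝ × ℝ) :=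
  {p | (m : ℝ) < a * p.1 + b * p.2 ∧ a * p.1 + b * p.2 < m + 1}

theorem convex_openStrip (a b m : ℤ) : Convex ℝ (openStrip a b m) := by
  have h : IsLinearMap ℝ fun p : ℝ × ℝ => a * p.1 + b * p.2 := by
    constructor
    · intro p q; simp only [Prod.fst_add, Prod.snd_add]; ring
    · intro c p; simp only [Prod.smul_fst, Prod.smul_snd, smul_eq_mul]; ring
  exact (convex_halfSpace_gt h _).inter (convex_halfSpace_lt h _)

theorem disjoint_openStrip (a b m : ℤ) : Disjoint (openStrip a b m) lattice := by
  rw [disjoint_lattice_iff]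
  rintro x y ⟨h1, h2⟩
  simp only at h1 h2
  norm_cast at h1 h2
  omega

theorem exists_int_lt_and_lt_add_one {x : ℝ} (hx : ∀ m : ℤ, x ≠ m) :
    ∃ m : ℤ, (m : ℝ) < x ∧ x < m + 1 :=
  ⟨⌊x⌋, lt_of_le_of_ne (Int.floor_le x) (hx _).symm, Int.lt_floor_add_one x⟩

theorem half_ne_int (z : ℤ) : (1 / 2 : ℝ) ≠ z := by
  intro h
  have : (1 : ℝ) = 2 * z := by linarith
  norm_cast at this
  omega

theorem mul_half_inv_ne {P : ℤ} (hP : P ≠ 0) (z : ℤ) : (P : ℝ) * (1 / (2 * P)) ≠ z := by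
  have hP' : (P : ℝ) ≠ 0 := by exact_mod_cast hP
  rw [show (P : ℝ) * (1 / (2 * P)) = 1 / 2 by field_simp]
  exact half_ne_int z

/-- The half-open vertical strip of width `1` on one side of the line `x = m` (the side is given by
the sign `ε`), together with the interval between the heights `j` and `j + 1` on that line. -/
def halfGate (ε : ℝ) (m j : ℤ) : Set (ℝ × ℝ) :=
  {p | 0 ≤ ε * (p.1 - m) ∧ ε * (p.1 - m) < 1 ∧
    (ε * (p.1 - m) = 0 → (j : ℝ) < p.2 ∧ p.2 < j + 1)}

theorem convex_halfGate (ε : ℝ) (m j : ℤ) : Convex ℝ (halfGate ε m j) := by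
  rw [convex_iff_forall_pos]
  rintro p ⟨hp0, hp1, hp⟩ q ⟨hq0, hq1, hq⟩ a b ha hb hab
  have e : ε * ((a • p + b • q).1 - m) = a * (ε * (p.1 - m)) + b * (ε * (q.1 - m)) := by
    simp only [Prod.fst_add, Prod.smul_fst, smul_eq_mul]
    linear_combination ε * m * hab
  have e2 : (a • p + b • q).2 = a * p.2 + b * q.2 := by simp
  refine ⟨?_, ?_, ?_⟩
  · rw [e]; positivity
  · rw [e]; nlinarith
  · rw [e, e2]
    intro h
    have h1 : 0 ≤ a * (ε * (p.1 - m)) := by positivity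
    have h2 : 0 ≤ b * (ε * (q.1 - m)) := by positivity
    have h3 : ε * (p.1 - m) = 0 := by
      have : a * (ε * (p.1 - m)) = 0 := by linarith
      exact (mul_eq_zero.1 this).resolve_left ha.ne'
    have h4 : ε * (q.1 - m) = 0 := by
      have : b * (ε * (q.1 - m)) = 0 := by linarith
      exact (mul_eq_zero.1 this).resolve_left hb.ne'
    exact convex_Ioo (j : ℝ) (j + 1) (hp h3) (hq h4) ha.le hb.le hab

theorem disjoint_halfGate {ε : ℝ} (hε : ε = 1 ∨ ε = -1) (m j : ℤ) :
    Disjoint (halfGate ε m j) lattice := by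
  rw [disjoint_lattice_iff]
  rintro x y ⟨h1, h2, h3⟩
  have hx : x = m := by
    rcases hε with rfl | rfl
    · simp only [one_mul] at h1 h2
      norm_cast at h1 h2
      omega
    · simp only [neg_mul, one_mul, neg_sub] at h1 h2
      norm_cast at h1 h2
      omega
  subst hx
  obtain ⟨h4, h5⟩ := h3 (by simp)
  simp only at h4 h5
  norm_cast at h4 h5
  omega

theorem ne_int_of_sign {ε : ℝ} (hε : ε = 1 ∨ ε = -1) {m : ℤ} {x : ℝ}
    (hx0 : 0 < ε * (x - m)) (hx1 : ε * (x - m) < 1) (z : ℤ) : x ≠ z := by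
  rintro rfl
  rcases hε with rfl | rfl
  · simp only [one_mul] at hx0 hx1
    norm_cast at hx0 hx1
    omega
  · simp only [neg_mul, one_mul, neg_sub] at hx0 hx1
    norm_cast at hx0 hx1
    omega

/-- The graph of an affine function. -/
def affineGraph (σ c : ℝ) : Set (ℝ × ℝ) := {p | p.2 = σ * p.1 + c}

theorem convex_affineGraph (σ c : ℝ) : Convex ℝ (affineGraph σ c) := by
  intro p hp q hq a b ha hb hab
  simp only [affineGraph, Set.mem_ofPred_eq, Prod.snd_add, Prod.fst_add, Prod.smul_fst,
    Prod.smul_snd, smul_eq_mul] at hp hq ⊢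
  rw [hp, hq]
  linear_combination c * hab

theorem disjoint_affineGraph {σ c : ℝ} (h : ∀ m z : ℤ, σ * m + c ≠ z) :
    Disjoint (affineGraph σ c) lattice := by
  rw [disjoint_lattice_iff]
  exact fun x y hxy => h x y hxy.symm

namespace IsTransport

variable {H : Type*} [Group H] {E : ℝ × ℝ → ℝ × ℝ → H}

/-! ### Vertical moves -/

theorem refl_eq (hE : IsTransport E) {C : Set (ℝ × ℝ)} (hC : Convex ℝ C) (hd : Disjoint C lattice)
    {p : ℝ × ℝ} (hp : p ∈ C) : E p p = 1 := by
  have := hE.mul_eq C p p p hC hd hp hp hp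
  simpa using this

theorem symm_eq (hE : IsTransport E) {C : Set (ℝ × ℝ)} (hC : Convex ℝ C) (hd : Disjoint C lattice)
    {p q : ℝ × ℝ} (hp : p ∈ C) (hq : q ∈ C) : E q p = (E p q)⁻¹ := by
  rw [eq_inv_iff_mul_eq_one, hE.mul_eq C p q p hC hd hp hq hp, hE.refl_eq hC hd hp]

theorem translate_eq (hE : IsTransport E) (v : ℤ × ℤ) (p q : ℝ × ℝ) :
    E (stepTwo p v) (stepTwo q v) = E p q := by
  rw [← hE.halfTurn_eq 0 p q, ← hE.halfTurn_eq v]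
  congr 1 <;> ext <;> simp [stepTwo]

theorem vertical_mul (hE : IsTransport E) {x : ℝ} (hx : ∀ m : ℤ, x ≠ m) (y y' y'' : ℝ) :
    E (x, y') (x, y'') * E (x, y) (x, y') = E (x, y) (x, y'') := by
  obtain ⟨m, h1, h2⟩ := exists_int_lt_and_lt_add_one hx
  exact hE.mul_eq _ _ _ _ (convex_openStrip 1 0 m) (disjoint_openStrip 1 0 m)
    (by simp [openStrip, h1, h2]) (by simp [openStrip, h1, h2]) (by simp [openStrip, h1, h2])

theorem vertical_zpow (hE : IsTransport E) {x : ℝ} (hx : ∀ m : ℤ, x ≠ m) (y : ℝ) (k : ℤ) :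
    E (x, y) (x, y + 2 * k) = E (x, y) (x, y + 2) ^ k := by
  have step (k : ℤ) : E (x, y + 2 * k) (x, y + 2 * (k + 1 : ℤ)) = E (x, y) (x, y + 2) := by
    rw [← hE.translate_eq (0, k) (x, y)]
    congr 1 <;> ext <;> simp [stepTwo]
    ring
  have h0 : E (x, y) (x, y) = 1 := by
    have := hE.vertical_mul hx y y y
    simpa using this
  induction k using Int.induction_on with
  | zero => simpa using h0
  | succ i ih =>
    rw [← hE.vertical_mul hx y (y + 2 * (i : ℤ)), step, ih, ← zpow_one_add, add_comm (1 : ℤ)]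
  | pred i ih =>
    have h := hE.vertical_mul hx y (y + 2 * (-i - 1 : ℤ)) (y + 2 * (-i - 1 + 1 : ℤ))
    rw [step, sub_add_cancel, ih] at h
    rw [← mul_right_inj (E (x, y) (x, y + 2)), h, ← zpow_one_add]
    congr 1
    ring

theorem vertical_eq_one (hE : IsTransport E) {r : ℤ}
    (hr : ∀ x : ℝ, (∀ m : ℤ, x ≠ m) → ∀ y, E (x, y) (x, y + 2) ^ r = 1)
    {x : ℝ} (hx : ∀ m : ℤ, x ≠ m) (y : ℝ) (k : ℤ) : E (x, y) (x, y + 2 * (r * k)) = 1 := by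
  have := hE.vertical_zpow hx y (r * k)
  rw [zpow_mul, hr x hx, one_zpow] at this
  simpa using this

/-! ### Comparing two lines -/

/-- Two paths that enter the line `x = m` through one gate, from the same side, have the same
transport up to vertical moves. -/
theorem same_gate (hE : IsTransport E) {ε : ℝ} (hε : ε = 1 ∨ ε = -1) {m j : ℤ} {x y y' z z' : ℝ}
    (hx0 : 0 < ε * (x - m)) (hx1 : ε * (x - m) < 1)
    (hz : (j : ℝ) < z ∧ z < j + 1) (hz' : (j : ℝ) < z' ∧ z' < j + 1) :
    E (m, z) (m, z') * E (x, y) (m, z) = E (x, y') (m, z') * E (x, y) (x, y') := by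
  have hx (t : ℝ) : (x, t) ∈ halfGate ε m j := ⟨hx0.le, hx1, fun h => absurd h hx0.ne'⟩
  have hm {t : ℝ} (ht : (j : ℝ) < t ∧ t < j + 1) : ((m : ℝ), t) ∈ halfGate ε m j :=
    ⟨by simp, by simp, fun _ => ht⟩
  have hc := convex_halfGate ε m j
  have hd := disjoint_halfGate hε m j
  rw [hE.mul_eq _ _ _ _ hc hd (hx y) (hm hz) (hm hz'),
    hE.mul_eq _ _ _ _ hc hd (hx y) (hx y') (hm hz')]

/-- The translation by `(0, 2 r k)` carries gates to gates congruent modulo `2 r`, and vertical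
moves by multiples of `2 r` are trivial off the lines `x = m`; so gates congruent modulo `2 r` are
as good as equal. The vertical move on the line `x = m` does not depend on the side `ε`. -/
theorem congruent_gate (hE : IsTransport E) {r : ℤ}
    (hr : ∀ x : ℝ, (∀ m : ℤ, x ≠ m) → ∀ y, E (x, y) (x, y + 2) ^ r = 1)
    {ε : ℝ} (hε : ε = 1 ∨ ε = -1) {m j k : ℤ} {x z z' : ℝ} (y y' : ℝ)
    (hx0 : 0 < ε * (x - m)) (hx1 : ε * (x - m) < 1)
    (hz : (j : ℝ) < z + 2 * (r * k) ∧ z + 2 * (r * k) < j + 1)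
    (hz' : (j : ℝ) < z' ∧ z' < j + 1) :
    E (m, z + 2 * (r * k)) (m, z') * E (x, y) (m, z) =
      E (x, y') (m, z') * E (x, y) (x, y') := by
  have hx := ne_int_of_sign hε hx0 hx1
  have h1 : E (x, y) (m, z) = E (x, y + 2 * (r * k)) (m, z + 2 * (r * k)) := by
    rw [← hE.translate_eq (0, r * k)]
    congr 1 <;> ext <;> simp [stepTwo]
  rw [h1, hE.same_gate hε hx0 hx1 hz hz' (y := y + 2 * (r * k)) (y' := y'),
    ← hE.vertical_mul hx y (y + 2 * (r * k)) y', hE.vertical_eq_one hr hx, mul_one]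

/-- Two lines that cross the line `x = m` in gates congruent modulo `2 r` have the same transport
across it, up to the vertical moves between them. -/
theorem crossing (hE : IsTransport E) {r : ℤ}
    (hr : ∀ x : ℝ, (∀ m : ℤ, x ≠ m) → ∀ y, E (x, y) (x, y + 2) ^ r = 1)
    {σ c σ' c' : ℝ} (hσ : ∀ m z : ℤ, σ * m + c ≠ z) (hσ' : ∀ m z : ℤ, σ' * m + c' ≠ z)
    {m j k : ℤ} (hz : (j : ℝ) < σ * m + c + 2 * (r * k) ∧ σ * m + c + 2 * (r * k) < j + 1)
    (hz' : (j : ℝ) < σ' * m + c' ∧ σ' * m + c' < j + 1) {x x' : ℝ}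
    (hx0 : m - 1 < x) (hx1 : x < m) (hx0' : m < x') (hx1' : x' < m + 1) :
    E (x', σ * x' + c) (x', σ' * x' + c') * E (x, σ * x + c) (x', σ * x' + c) =
      E (x, σ' * x + c') (x', σ' * x' + c') * E (x, σ * x + c) (x, σ' * x + c') := by
  have L := hE.congruent_gate hr (Or.inr rfl) (σ * x + c) (σ' * x + c')
    (by linarith) (by linarith) hz hz' (m := m) (x := x)
  have R := hE.congruent_gate hr (Or.inl rfl) (σ * x' + c) (σ' * x' + c')
    (by linarith) (by linarith) hz hz' (m := m) (x := x')
  have key {σ c : ℝ} (hσ : ∀ m z : ℤ, σ * m + c ≠ z) :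
      E (x, σ * x + c) (x', σ * x' + c) =
        (E (x', σ * x' + c) (m, σ * m + c))⁻¹ * E (x, σ * x + c) (m, σ * m + c) := by
    have hc := convex_affineGraph σ c
    have hd := disjoint_affineGraph hσ
    have h (t : ℝ) : (t, σ * t + c) ∈ affineGraph σ c := rfl
    rw [← hE.symm_eq hc hd (h x') (h m), hE.mul_eq _ _ _ _ hc hd (h x) (h m) (h x')]
  rw [key hσ, key hσ', mul_assoc, ← L, ← mul_assoc, ← mul_assoc]
  congr 1
  rw [eq_inv_mul_iff_mul_eq, ← mul_assoc, ← R, mul_inv_cancel_right]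

/-- Consecutive crossings compose, because the vertical connector at the end of one is the connector
at the start of the next. -/
theorem crossings (hE : IsTransport E) {r : ℤ}
    (hr : ∀ x : ℝ, (∀ m : ℤ, x ≠ m) → ∀ y, E (x, y) (x, y + 2) ^ r = 1)
    {σ c σ' c' : ℝ}
    (hg : ∀ m : ℤ, ∃ j k : ℤ,
      ((j : ℝ) < σ * m + c + 2 * (r * k) ∧ σ * m + c + 2 * (r * k) < j + 1) ∧
      ((j : ℝ) < σ' * m + c' ∧ σ' * m + c' < j + 1))
    (hσ : ∀ m z : ℤ, σ * m + c ≠ z) (hσ' : ∀ m z : ℤ, σ' * m + c' ≠ z)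
    {x : ℝ} (hx0 : 0 < x) (hx1 : x < 1) (N : ℕ) :
    E (x + N, σ * (x + N) + c) (x + N, σ' * (x + N) + c') *
        E (x, σ * x + c) (x + N, σ * (x + N) + c) =
      E (x, σ' * x + c') (x + N, σ' * (x + N) + c') * E (x, σ * x + c) (x, σ' * x + c') := by
  have h {σ c : ℝ} (t : ℝ) : (t, σ * t + c) ∈ affineGraph σ c := rfl
  induction N with
  | zero =>
    have h1 {σ c : ℝ} (hσ : ∀ m z : ℤ, σ * m + c ≠ z) : E (x, σ * x + c) (x, σ * x + c) = 1 :=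
      hE.refl_eq (convex_affineGraph σ c) (disjoint_affineGraph hσ) (h x)
    simp only [CharP.cast_eq_zero, add_zero]
    rw [h1 hσ, h1 hσ', mul_one, one_mul]
  | succ N ih =>
    have split {σ c : ℝ} (hσ : ∀ m z : ℤ, σ * m + c ≠ z) := hE.mul_eq _ _ _ _
      (convex_affineGraph σ c) (disjoint_affineGraph hσ) (h x) (h (x + N)) (h (x + (N + 1 : ℕ)))
    obtain ⟨j, k, hz, hz'⟩ := hg (N + 1)
    have hc := hE.crossing hr hσ hσ' hz hz' (x := x + N) (x' := x + (N + 1 : ℕ))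
      (by push_cast; linarith) (by push_cast; linarith) (by push_cast; linarith)
      (by push_cast; linarith)
    rw [← split hσ, ← split hσ', ← mul_assoc, hc, mul_assoc, ih, mul_assoc]

/-- Lines of directions `(P, Q)` and `(P, Q')` through gates congruent modulo `2 r` have conjugate
transports. -/
theorem isConj_of_gates (hE : IsTransport E) {r : ℤ}
    (hr : ∀ x : ℝ, (∀ m : ℤ, x ≠ m) → ∀ y, E (x, y) (x, y + 2) ^ r = 1)
    {P Q Q' l : ℤ} (hP : 0 < P) (hQ : Q' = Q + r * l) {c c' : ℝ}
    (hσ : ∀ m z : ℤ, (Q / P : ℝ) * m + c ≠ z) (hσ' : ∀ m z : ℤ, (Q' / P : ℝ) * m + c' ≠ z)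
    (hg : ∀ m : ℤ, ∃ j k : ℤ,
      ((j : ℝ) < Q / P * m + c + 2 * (r * k) ∧ Q / P * m + c + 2 * (r * k) < j + 1) ∧
      ((j : ℝ) < Q' / P * m + c' ∧ Q' / P * m + c' < j + 1)) :
    IsConj (E (1 / 2, Q / P * (1 / 2) + c) (stepTwo (1 / 2, Q / P * (1 / 2) + c) (P, Q)))
      (E (1 / 2, Q' / P * (1 / 2) + c') (stepTwo (1 / 2, Q' / P * (1 / 2) + c') (P, Q'))) := by
  have hP' : (P : ℝ) ≠ 0 := by exact_mod_cast hP.ne'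
  have hx : ∀ m : ℤ, (1 / 2 : ℝ) ≠ m := by
    intro m h
    have : (1 : ℝ) = 2 * m := by linarith
    norm_cast at this
    omega
  obtain ⟨N, rfl⟩ := Int.eq_ofNat_of_zero_le hP.le
  have h := hE.crossings hr hg hσ hσ' (x := 1 / 2) (by norm_num) (by norm_num) (2 * N)
  have e (Q : ℤ) (c : ℝ) : ((1 / 2 + (2 * N : ℕ),
      (Q / (N : ℤ) : ℝ) * (1 / 2 + (2 * N : ℕ)) + c) : ℝ × ℝ) =
      stepTwo (1 / 2, Q / (N : ℤ) * (1 / 2) + c) (N, Q) := by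
    simp only [Int.cast_natCast, ne_eq] at hP'
    ext <;> simp [stepTwo]
    field_simp
    ring
  rw [e, e] at h
  set y := (Q / (N : ℤ) : ℝ) * (1 / 2) + c
  set y' := (Q' / (N : ℤ) : ℝ) * (1 / 2) + c'
  -- the two ends of the vertical connector differ by a multiple of the vertical period
  have hv : E (stepTwo (1 / 2, y) (N, Q)) (stepTwo (1 / 2, y') (N, Q')) =
      E (1 / 2, y) (1 / 2, y') := by
    have e' : stepTwo (1 / 2, y') (N, Q') = stepTwo (1 / 2, y' + 2 * (r * l)) (N, Q) := by
      ext <;> simp [stepTwo, hQ]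
      ring
    rw [e', hE.translate_eq, ← hE.vertical_mul hx y y' (y' + 2 * (r * l)),
      hE.vertical_eq_one hr hx, one_mul]
  rw [hv] at h
  rw [isConj_iff]
  exact ⟨_, by rw [h, mul_inv_cancel_right]⟩

end IsTransport

/-! ### The class of a direction -/

theorem mem_unorientedConjClass_self {G : Type*} [Group G] (g : G) : g ∈ unorientedConjClass g :=
  Or.inl (IsConj.refl g)

theorem unorientedConjClass_inv {G : Type*} [Group G] (g : G) :
    unorientedConjClass g⁻¹ = unorientedConjClass g := by
  ext h
  simp only [unorientedConjClass, Set.mem_ofPred_eq, inv_inv]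
  exact or_comm

theorem isConj_inv_inv {G : Type*} [Group G] {g h : G} (hgh : IsConj g h) : IsConj g⁻¹ h⁻¹ := by
  rw [isConj_iff] at hgh ⊢
  obtain ⟨c, rfl⟩ := hgh
  exact ⟨c, by group⟩

theorem unorientedConjClass_congr {G : Type*} [Group G] {g h : G} (hgh : IsConj g h) :
    unorientedConjClass g = unorientedConjClass h := by
  have hi := isConj_inv_inv hgh
  ext k
  exact ⟨Or.imp hgh.symm.trans hi.symm.trans, Or.imp hgh.trans hi.trans⟩

theorem unorientedConjClass_one {G : Type*} [Group G] :
    unorientedConjClass (1 : G) = {1} := by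
  ext h
  simp [unorientedConjClass]

theorem avoids_of_ne {d : ℤ × ℤ} {p : ℝ × ℝ} (h : ∀ z : ℤ, d.1 * p.2 - d.2 * p.1 ≠ z) :
    Avoids d p := by
  rintro t ⟨v, hv⟩
  rw [Prod.ext_iff] at hv
  obtain ⟨h1, h2⟩ := hv
  simp only at h1 h2
  apply h (d.1 * v.2 - d.2 * v.1)
  push_cast
  rw [h1, h2]
  ring

/-- For primitive `d`, every line `d.1 y - d.2 x = z` contains a lattice point. -/
theorem exists_cross_eq {d : ℤ × ℤ} (hd : IsCoprime d.1 d.2) (z : ℤ) :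
    ∃ v : ℤ × ℤ, d.1 * v.2 - d.2 * v.1 = z := by
  obtain ⟨a, b, h⟩ := hd
  exact ⟨(-(z * b), z * a), by linear_combination z * h⟩

theorem Avoids.cross_ne {d : ℤ × ℤ} (hd : IsCoprime d.1 d.2) {p : ℝ × ℝ} (h : Avoids d p)
    (z : ℤ) : d.1 * p.2 - d.2 * p.1 ≠ z := by
  intro hz
  obtain ⟨v, hv⟩ := exists_cross_eq hd z
  obtain ⟨a, b, hab⟩ := hd
  have hab' : (a * d.1 + b * d.2 : ℝ) = 1 := by exact_mod_cast hab
  have hv' : (d.1 * v.2 - d.2 * v.1 : ℝ) = z := by exact_mod_cast hv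
  -- `p - v` is parallel to `d`
  refine h (-(a * (p.1 - v.1) + b * (p.2 - v.2))) ⟨v, ?_⟩
  have hc : d.1 * (p.2 - v.2) - d.2 * (p.1 - v.1) = 0 := by linear_combination hz - hv'
  ext
  · simp only
    linear_combination (p.1 - v.1) * hab' + b * hc
  · simp only
    linear_combination (p.2 - v.2) * hab' - a * hc

theorem avoids_graph_point {P Q : ℤ} (hP : P ≠ 0) {c : ℝ} (hc : ∀ z : ℤ, P * c ≠ z) :
    Avoids (P, Q) (1 / 2, Q / P * (1 / 2) + c) := by
  have hP' : (P : ℝ) ≠ 0 := by exact_mod_cast hP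
  apply avoids_of_ne
  intro z h
  apply hc z
  rw [← h]
  field_simp
  ring

theorem graph_ne_int {P : ℤ} (hP : P ≠ 0) {c : ℝ} (hc : ∀ z : ℤ, P * c ≠ z) (Q m z : ℤ) :
    (Q / P : ℝ) * m + c ≠ z := by
  have hP' : (P : ℝ) ≠ 0 := by exact_mod_cast hP
  intro h
  apply hc (P * z - Q * m)
  push_cast
  rw [← h]
  field_simp
  ring

theorem stepTwo_mem_openStrip {d : ℤ × ℤ} {p : ℝ × ℝ} {m : ℤ}
    (hp : p ∈ openStrip (-d.2) d.1 m) : stepTwo p d ∈ openStrip (-d.2) d.1 m := by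
  obtain ⟨h1, h2⟩ := hp
  have e : ((-d.2 : ℤ) : ℝ) * (stepTwo p d).1 + d.1 * (stepTwo p d).2 =
      (-d.2 : ℤ) * p.1 + d.1 * p.2 := by
    simp [stepTwo]; ring
  exact ⟨by rw [e]; exact h1, by rw [e]; exact h2⟩

/-- Exchanging the two coordinates exchanges the coordinates of directions. -/
theorem transportClass_swap {H : Type*} [Group H] (E : ℝ × ℝ → ℝ × ℝ → H) (d : ℤ × ℤ) :
    transportClass (fun p q => E p.swap q.swap) d.swap = transportClass E d := by
  have h (p : ℝ × ℝ) : Avoids d.swap p ↔ Avoids d p.swap := by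
    refine forall_congr' fun t => not_congr ?_
    constructor
    · rintro ⟨v, hv⟩
      exact ⟨v.swap, congrArg Prod.swap hv⟩
    · rintro ⟨v, hv⟩
      exact ⟨v.swap, congrArg Prod.swap hv⟩
  ext g
  constructor
  · rintro ⟨p, hp, hg⟩
    exact ⟨p.swap, (h p).1 hp, hg⟩
  · rintro ⟨p, hp, hg⟩
    exact ⟨p.swap, (h _).2 hp, hg⟩

namespace IsTransport

variable {H : Type*} [Group H] {E : ℝ × ℝ → ℝ × ℝ → H}

/-- Moving a line within a strip between consecutive lattice lines conjugates its transport. -/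
theorem isConj_of_mem_openStrip (hE : IsTransport E) {d : ℤ × ℤ} {p q : ℝ × ℝ} {m : ℤ}
    (hp : p ∈ openStrip (-d.2) d.1 m) (hq : q ∈ openStrip (-d.2) d.1 m) :
    IsConj (E p (stepTwo p d)) (E q (stepTwo q d)) := by
  have hc := convex_openStrip (-d.2) d.1 m
  have hd := disjoint_openStrip (-d.2) d.1 m
  have h1 := hE.mul_eq _ _ _ _ hc hd hp (stepTwo_mem_openStrip hp) (stepTwo_mem_openStrip hq)
  have h2 := hE.mul_eq _ _ _ _ hc hd hp hq (stepTwo_mem_openStrip hq)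
  rw [hE.translate_eq, ← h2] at h1
  rw [isConj_iff]
  exact ⟨E p q, by rw [h1, mul_inv_cancel_right]⟩

/-- A half-turn reverses the direction of a line. -/
theorem halfTurn_stepTwo (hE : IsTransport E) {d : ℤ × ℤ} (v : ℤ × ℤ) {p : ℝ × ℝ} {m : ℤ}
    (hp : ((2 * v.1 - p.1, 2 * v.2 - p.2) : ℝ × ℝ) ∈ openStrip (-d.2) d.1 m) :
    E p (stepTwo p d) = (E (2 * v.1 - p.1, 2 * v.2 - p.2)
      (stepTwo (2 * v.1 - p.1, 2 * v.2 - p.2) d))⁻¹ := by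
  set q : ℝ × ℝ := (2 * v.1 - p.1, 2 * v.2 - p.2) with hq
  rw [← hE.symm_eq (convex_openStrip _ _ m) (disjoint_openStrip _ _ m) hp
    (stepTwo_mem_openStrip hp), ← hE.halfTurn_eq v, ← hE.translate_eq d]
  congr 1
  ext <;> simp [stepTwo, hq] <;> ring

/-- All lines of a primitive direction that avoid the lattice have the same transport up to
conjugation and inversion: the deck group permutes the strips between the lattice lines of that
direction transitively. -/
theorem transportClass_eq (hE : IsTransport E) {d : ℤ × ℤ} (hd : IsCoprime d.1 d.2) {p : ℝ × ℝ}
    (hp : Avoids d p) : transportClass E d = unorientedConjClass (E p (stepTwo p d)) := by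
  have strip {p : ℝ × ℝ} (hp : Avoids d p) : ∃ m : ℤ, p ∈ openStrip (-d.2) d.1 m := by
    obtain ⟨m, h1, h2⟩ := exists_int_lt_and_lt_add_one (hp.cross_ne hd)
    exact ⟨m, by push_cast; linarith, by push_cast; linarith⟩
  have key (q : ℝ × ℝ) (hq : Avoids d q) : unorientedConjClass (E q (stepTwo q d)) =
      unorientedConjClass (E p (stepTwo p d)) := by
    obtain ⟨m, hm⟩ := strip hp
    obtain ⟨l, hl⟩ := strip hq
    obtain ⟨h1, h2⟩ := hl
    push_cast at h1 h2
    obtain ⟨k, hk | hk⟩ := Int.even_or_odd' (m - l)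
    -- an even difference of strips is undone by a translation, an odd one by a half-turn
    · obtain ⟨v, hv⟩ := exists_cross_eq hd k
      have hv' : (d.1 * v.2 - d.2 * v.1 : ℝ) = k := by exact_mod_cast hv
      have hk' : (m - l : ℝ) = 2 * k := by exact_mod_cast hk
      have hmem : stepTwo q v ∈ openStrip (-d.2) d.1 m := by
        constructor <;> simp only [stepTwo] <;> push_cast <;> linarith
      have e : stepTwo (stepTwo q v) d = stepTwo (stepTwo q d) v := by
        ext <;> simp [stepTwo] <;> ring
      have := hE.isConj_of_mem_openStrip hmem hm
      rw [e, hE.translate_eq] at this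
      exact unorientedConjClass_congr this
    · obtain ⟨v, hv⟩ := exists_cross_eq hd (l + k + 1)
      have hv' : (d.1 * v.2 - d.2 * v.1 : ℝ) = l + k + 1 := by exact_mod_cast hv
      have hk' : (m - l : ℝ) = 2 * k + 1 := by exact_mod_cast hk
      have hmem : ((2 * v.1 - q.1, 2 * v.2 - q.2) : ℝ × ℝ) ∈ openStrip (-d.2) d.1 m := by
        constructor <;> simp only <;> push_cast <;> linarith
      rw [hE.halfTurn_stepTwo v hmem, unorientedConjClass_inv]
      exact unorientedConjClass_congr (hE.isConj_of_mem_openStrip hmem hm)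
  ext h
  constructor
  · rintro ⟨q, hq, hh⟩
    rwa [key q hq] at hh
  · exact fun hh => ⟨p, hp, hh⟩

theorem transportClass_neg (hE : IsTransport E) {d d' : ℤ × ℤ} (hd : IsCoprime d.1 d.2)
    (hd' : d' = -d) {p : ℝ × ℝ} (hp : Avoids d p) : transportClass E d' = transportClass E d := by
  subst hd'
  have hp' : Avoids (-d) p := by
    intro t h
    apply hp (-t)
    convert h using 2 <;> simp
  have hc : IsCoprime (-d).1 (-d).2 := hd.neg_neg
  obtain ⟨m, h1, h2⟩ := exists_int_lt_and_lt_add_one (hp.cross_ne hd)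
  have hm : p ∈ openStrip (-d.2) d.1 m := ⟨by push_cast; linarith, by push_cast; linarith⟩
  have e : E p (stepTwo p (-d)) = (E p (stepTwo p d))⁻¹ := by
    rw [← hE.symm_eq (convex_openStrip _ _ m) (disjoint_openStrip _ _ m) hm
      (stepTwo_mem_openStrip hm), ← hE.translate_eq d]
    congr 1
    ext <;> simp [stepTwo]
  rw [hE.transportClass_eq hd hp, hE.transportClass_eq hc hp', e, unorientedConjClass_inv]

/-! ### Slopes with the same class -/

/-- If going once around the vertical loop is trivial, the class of a direction is invariant under
the reflection `x ↦ 2 k - x` of slopes: the line `y = f x` is compared with its mirror image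
`y = 1 - f x + 2 k x`. -/
theorem transportClass_reflection (hE : IsTransport E)
    (hv : ∀ x : ℝ, (∀ m : ℤ, x ≠ m) → ∀ y, E (x, y) (x, y + 2) = 1)
    {P Q : ℤ} (hP : 0 < P) (hPQ : IsCoprime P Q) (k : ℤ) :
    transportClass E (P, 2 * k * P - Q) = transportClass E (P, Q) := by
  have hP' : (P : ℝ) ≠ 0 := by exact_mod_cast hP.ne'
  have hc := mul_half_inv_ne hP.ne'
  have hc' (z : ℤ) : (P : ℝ) * (1 - 1 / (2 * P)) ≠ z := by
    intro h
    apply hc (P - z)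
    push_cast
    linarith
  have hcop : IsCoprime P (2 * k * P - Q) := by
    rw [show 2 * k * P - Q = -Q + P * (2 * k) by ring]
    exact hPQ.neg_right.add_mul_left_right _
  have hσ := graph_ne_int hP.ne' hc Q
  have hσ' := graph_ne_int hP.ne' hc' (2 * k * P - Q)
  rw [hE.transportClass_eq hPQ (avoids_graph_point hP.ne' hc),
    hE.transportClass_eq hcop (avoids_graph_point hP.ne' hc')]
  refine (unorientedConjClass_congr (hE.isConj_of_gates (r := 1) (l := 2 * k * P - 2 * Q)
    (by simpa using hv) hP (by ring) hσ hσ' ?_)).symm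
  intro m
  obtain ⟨j, h1, h2⟩ := exists_int_lt_and_lt_add_one (hσ m)
  have e : ((2 * k * P - Q : ℤ) : ℝ) / P * m + (1 - 1 / (2 * P)) =
      2 * k * m + 1 - (Q / P * m + 1 / (2 * P)) := by
    push_cast
    field_simp
    ring
  refine ⟨2 * k * m - j, k * m - j, ⟨?_, ?_⟩, ?_, ?_⟩
  all_goals first | rw [e] | skip
  all_goals push_cast; linarith

/-- If going `r` times around the vertical loop is trivial, the class of a direction is invariant
under the `2 r`-fold shear along the vertical direction. -/
theorem transportClass_shear (hE : IsTransport E) {r : ℤ}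
    (hr : ∀ x : ℝ, (∀ m : ℤ, x ≠ m) → ∀ y, E (x, y) (x, y + 2) ^ r = 1)
    {P Q : ℤ} (hP : 0 < P) (hPQ : IsCoprime P Q) :
    transportClass E (P, Q + 2 * r * P) = transportClass E (P, Q) := by
  have hP' : (P : ℝ) ≠ 0 := by exact_mod_cast hP.ne'
  have hc := mul_half_inv_ne hP.ne'
  have hcop : IsCoprime P (Q + 2 * r * P) := by
    rw [show Q + 2 * r * P = Q + P * (2 * r) by ring]
    exact hPQ.add_mul_left_right _
  have hσ := graph_ne_int hP.ne' hc Q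
  have hσ' := graph_ne_int hP.ne' hc (Q + 2 * r * P)
  rw [hE.transportClass_eq hPQ (avoids_graph_point hP.ne' hc),
    hE.transportClass_eq hcop (avoids_graph_point hP.ne' hc)]
  refine (unorientedConjClass_congr (hE.isConj_of_gates (r := r) (l := 2 * P)
    hr hP (by ring) hσ hσ' ?_)).symm
  intro m
  obtain ⟨j, h1, h2⟩ := exists_int_lt_and_lt_add_one (hσ' m)
  have e : ((Q + 2 * r * P : ℤ) : ℝ) / P * m + 1 / (2 * P) =
      Q / P * m + 1 / (2 * P) + 2 * (r * m) := by
    push_cast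
    field_simp
    ring
  exact ⟨j, m, ⟨by rwa [← e], by rwa [← e]⟩, h1, h2⟩

theorem swap (hE : IsTransport E) : IsTransport fun p q => E p.swap q.swap where
  mul_eq C p q r hC hd hp hq hr := by
    refine hE.mul_eq (Prod.swap ⁻¹' C) _ _ _ ?_ ?_ (by simpa) (by simpa) (by simpa)
    · intro x hx y hy a b ha hb hab
      exact hC hx hy ha hb hab
    · rw [disjoint_lattice_iff] at hd ⊢
      exact fun a b => hd b a
  halfTurn_eq v p q := hE.halfTurn_eq v.swap p.swap q.swap

end IsTransport

/-! ### Transports from holonomies of the Conway sphere -/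

open unitInterval

/-- A holonomy on `X` with values in a group: an assignment to paths that is invariant under
homotopy and composes in the order of functions. -/
structure IsHolonomy {X H : Type*} [TopologicalSpace X] [Group H]
    (Φ : ∀ a b : X, Path a b → H) : Prop where
  homotopic : ∀ {a b : X} {γ γ' : Path a b}, γ.Homotopic γ' → Φ a b γ = Φ a b γ'
  trans : ∀ {a b c : X} (γ : Path a b) (γ' : Path b c), Φ a c (γ.trans γ') = Φ b c γ' * Φ a b γ

theorem holonomy_congr {X H : Type*} [TopologicalSpace X] (Φ : ∀ a b : X, Path a b → H)
    {a b a' b' : X} (γ : Path a b) (γ' : Path a' b') (h : ∀ t, γ t = γ' t) :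
    Φ a b γ = Φ a' b' γ' := by
  obtain rfl : a = a' := by rw [← γ.source, h, γ'.source]
  obtain rfl : b = b' := by rw [← γ.target, h, γ'.target]
  congr 1
  ext t
  exact h t

/-- The point at time `t` on the straight segment from `p` to `q`. -/
def seg (p q : ℝ × ℝ) (t : ℝ) : ℝ × ℝ := (p.1 + t * (q.1 - p.1), p.2 + t * (q.2 - p.2))

theorem seg_zero (p q : ℝ × ℝ) : seg p q 0 = p := by simp [seg]

theorem seg_one (p q : ℝ × ℝ) : seg p q 1 = q := by simp [seg]

theorem seg_mem {C : Set (ℝ × ℝ)} (hC : Convex ℝ C) {p q : ℝ × ℝ} (hp : p ∈ C) (hq : q ∈ C)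
    (t : I) : seg p q t ∈ C := by
  have := hC hp hq (a := 1 - t) (b := t) (by have := t.2.2; linarith) t.2.1 (by ring)
  convert this using 1
  ext <;> simp [seg] <;> ring

/-- The segment from `p` to `q` avoids the lattice. -/
def SegAvoids (p q : ℝ × ℝ) : Prop := ∀ t : I, seg p q t ∉ lattice

/-- A point outside the lattice, as a point of the punctured plane. -/
def toPunctured (p : ℝ × ℝ) (h : p ∉ lattice) : PuncturedPlane := ⟨p, fun v hv => h ⟨v, hv.symm⟩⟩

/-- The projection to the Conway sphere of the segment from `p` to `q`. -/
def segPath (p q : ℝ × ℝ) (h : SegAvoids p q) :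
    Path (proj (toPunctured (seg p q (0 : I)) (h 0))) (proj (toPunctured (seg p q (1 : I)) (h 1)))
    where
  toFun t := proj (toPunctured (seg p q t) (h t))
  continuous_toFun := continuous_proj.comp (by unfold toPunctured seg; fun_prop)
  source' := rfl
  target' := rfl

open Classical in
/-- The holonomy of the projections of straight segments, with value `1` on the segments that meet
the lattice. -/
def segTransport {H : Type*} [Group H] (Φ : ∀ a b : ConwaySphere, Path a b → H)
    (p q : ℝ × ℝ) : H :=
  if h : SegAvoids p q then Φ _ _ (segPath p q h) else 1

theorem segTransport_eq {H : Type*} [Group H] (Φ : ∀ a b : ConwaySphere, Path a b → H)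
    {p q : ℝ × ℝ} (h : SegAvoids p q) {a b : ConwaySphere} (γ : Path a b)
    (hγ : ∀ t, γ t = proj (toPunctured (seg p q t) (h t))) :
    segTransport Φ p q = Φ a b γ := by
  rw [segTransport, dif_pos h]
  exact holonomy_congr Φ _ _ fun t => (hγ t).symm

theorem halfTurn_seg (v : ℤ × ℤ) (p q : ℝ × ℝ) (t : ℝ) :
    seg (2 * v.1 - p.1, 2 * v.2 - p.2) (2 * v.1 - q.1, 2 * v.2 - q.2) t =
      (2 * v.1 - (seg p q t).1, 2 * v.2 - (seg p q t).2) := by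
  ext <;> simp [seg] <;> ring

theorem halfTurn_mem_lattice (v : ℤ × ℤ) {p : ℝ × ℝ} :
    ((2 * v.1 - p.1, 2 * v.2 - p.2) : ℝ × ℝ) ∈ lattice ↔ p ∈ lattice := by
  have key (p : ℝ × ℝ) (hp : p ∈ lattice) :
      ((2 * v.1 - p.1, 2 * v.2 - p.2) : ℝ × ℝ) ∈ lattice := by
    obtain ⟨w, rfl⟩ := hp
    exact ⟨(2 * v.1 - w.1, 2 * v.2 - w.2), by simp⟩
  refine ⟨fun h => ?_, key p⟩
  simpa using key _ h

theorem proj_halfTurn (v : ℤ × ℤ) (p q : PuncturedPlane)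
    (h : q.1 = (2 * v.1 - p.1.1, 2 * v.2 - p.1.2)) : proj q = proj p := by
  apply Quotient.sound
  exact ⟨⟨halfTurn v, Subgroup.subset_closure ⟨v, rfl⟩⟩, Subtype.ext h.symm⟩

/-- Composition holds inside convex sets because they are contractible; invariance holds because a
half-turn does not change the projection of a segment. -/
theorem isTransport_segTransport {H : Type*} [Group H] {Φ : ∀ a b : ConwaySphere, Path a b → H}
    (hΦ : IsHolonomy Φ) : IsTransport (segTransport Φ) where
  mul_eq C p q r hC hd hp hq hr := by
    have hmem (x : C) : x.1 ∉ lattice := fun h => Set.disjoint_left.1 hd x.2 h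
    have : ContractibleSpace C := hC.contractibleSpace ⟨p, hp⟩
    let ι : C(C, ConwaySphere) :=
      ⟨fun x => proj (toPunctured x (hmem x)),
        continuous_proj.comp (by unfold toPunctured; fun_prop)⟩
    let path (p q : ℝ × ℝ) (hp : p ∈ C) (hq : q ∈ C) : Path (⟨p, hp⟩ : C) ⟨q, hq⟩ :=
      { toFun := fun t => ⟨seg p q t, seg_mem hC hp hq t⟩
        continuous_toFun := by unfold seg; fun_prop
        source' := Subtype.ext (seg_zero p q)
        target' := Subtype.ext (seg_one p q) }
    have hseg (p q : ℝ × ℝ) (hp : p ∈ C) (hq : q ∈ C) :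
        segTransport Φ p q = Φ _ _ ((path p q hp hq).map ι.continuous) :=
      segTransport_eq Φ (fun t => hmem ⟨_, seg_mem hC hp hq t⟩) _ fun t => rfl
    rw [hseg q r hq hr, hseg p q hp hq, hseg p r hp hr, ← hΦ.trans, ← Path.map_trans]
    exact hΦ.homotopic ((SimplyConnectedSpace.paths_homotopic _ _).map ι)
  halfTurn_eq v p q := by
    have hiff : SegAvoids (2 * v.1 - p.1, 2 * v.2 - p.2) (2 * v.1 - q.1, 2 * v.2 - q.2) ↔
        SegAvoids p q :=
      forall_congr' fun t => not_congr (by rw [halfTurn_seg, halfTurn_mem_lattice])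
    by_cases h : SegAvoids p q
    · rw [segTransport_eq Φ (hiff.2 h) (segPath p q h), segTransport_eq Φ h (segPath p q h)]
      · exact fun t => rfl
      · exact fun t => (proj_halfTurn v _ _ (halfTurn_seg v p q t)).symm
    · rw [segTransport, segTransport, dif_neg (mt hiff.1 h), dif_neg h]

theorem avoids_direction_iff {s : OnePoint ℚ} {p : ℝ × ℝ} :
    Avoids (direction s) p ↔ LineAvoidsLattice s p := by
  refine forall_congr' fun t => ⟨fun h v hv => h ⟨v, hv.symm⟩, ?_⟩
  rintro h ⟨v, hv⟩
  exact h v hv.symm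

theorem segTransport_stepTwo {H : Type*} [Group H] (Φ : ∀ a b : ConwaySphere, Path a b → H)
    (s : OnePoint ℚ) (p : ℝ × ℝ) (h : LineAvoidsLattice s p) :
    segTransport Φ p (stepTwo p (direction s)) = Φ _ _ (slopeLoop s p h) := by
  have e (t : ℝ) : seg p (stepTwo p (direction s)) t = linePoint s p (2 * t) := by
    ext <;> simp [seg, stepTwo, linePoint] <;> ring
  refine segTransport_eq Φ (fun t => ?_) _ fun t => ?_
  · rw [e]
    rintro ⟨v, hv⟩
    exact h _ v hv.symm
  · exact congrArg proj (Subtype.ext (e t).symm)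

/-! ### The holonomy of a quotient of the fundamental group -/

/-- The holonomy that a homomorphism `ψ` from the fundamental group induces when every point `a` is
joined to the base point by a chosen path `δ a`. -/
def baseHolonomy {X H : Type*} [TopologicalSpace X] [Group H] {x₀ : X}
    (ψ : FundamentalGroup X x₀ →* H) (δ : ∀ a, Path x₀ a) (a b : X) (γ : Path a b) : H :=
  ψ (FundamentalGroup.fromPath
    (Path.Homotopic.Quotient.mk (((δ a).trans γ).trans (δ b).symm)))

open Path.Homotopic in
theorem symm_trans_cancel {X : Type*} [TopologicalSpace X] {a b c : X}
    (p : Path.Homotopic.Quotient a b) (q : Path.Homotopic.Quotient b c) :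
    p.symm.trans (p.trans q) = q := by
  rw [← Quotient.trans_assoc, Quotient.symm_trans, Quotient.refl_trans]

open Path.Homotopic in
theorem isHolonomy_baseHolonomy {X H : Type*} [TopologicalSpace X] [Group H] {x₀ : X}
    (ψ : FundamentalGroup X x₀ →* H) (δ : ∀ a, Path x₀ a) : IsHolonomy (baseHolonomy ψ δ) where
  homotopic h := by
    unfold baseHolonomy
    congr 2
    exact Quotient.eq.2 (((Path.Homotopic.refl _).hcomp h).hcomp (Path.Homotopic.refl _))
  trans γ γ' := by
    unfold baseHolonomy
    rw [← map_mul, FundamentalGroup.mul_def]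
    congr 1
    simp only [FundamentalGroup.fromPath, FundamentalGroup.fromArrow, Quotient.mk_trans,
      Quotient.mk_symm, Quotient.trans_assoc, symm_trans_cancel]

open Path.Homotopic in
theorem isConj_baseHolonomy {X H : Type*} [TopologicalSpace X] [Group H] {x₀ : X}
    (ψ : FundamentalGroup X x₀ →* H) (δ : ∀ a, Path x₀ a) {a : X} (α : Path a a) (γ : Path x₀ a) :
    IsConj (baseHolonomy ψ δ a a α) (ψ (FundamentalGroup.fromPath
      (Path.Homotopic.Quotient.mk ((γ.trans α).trans γ.symm)))) := by
  refine IsConj.symm (isConj_iff.2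
    ⟨ψ (FundamentalGroup.fromPath (Path.Homotopic.Quotient.mk (γ.trans (δ a).symm))), ?_⟩)
  unfold baseHolonomy
  rw [mul_inv_eq_iff_eq_mul, ← map_mul, ← map_mul, FundamentalGroup.mul_def,
    FundamentalGroup.mul_def]
  congr 1
  simp only [FundamentalGroup.fromPath, FundamentalGroup.fromArrow, Quotient.mk_trans,
    Quotient.mk_symm, Quotient.trans_assoc, symm_trans_cancel]

open Path.Homotopic in
/-- The unoriented class of `α_s` in a quotient of the fundamental group is the class of the
direction of `s` for the associated transport. -/
theorem image_slopeClass {H : Type*} [Group H] {x₀ : ConwaySphere}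
    (ψ : FundamentalGroup ConwaySphere x₀ →* H) (hψ : Function.Surjective ψ)
    (δ : ∀ a, Path x₀ a) (s : OnePoint ℚ) :
    ψ '' slopeClass x₀ s = transportClass (segTransport (baseHolonomy ψ δ)) (direction s) := by
  ext h
  constructor
  · rintro ⟨g, ⟨p, hp, γ, hg⟩, rfl⟩
    refine ⟨p, avoids_direction_iff.2 hp, ?_⟩
    rw [segTransport_stepTwo _ s p hp]
    have := isConj_baseHolonomy ψ δ (slopeLoop s p hp) γ
    rcases hg with rfl | rfl
    · exact Or.inl this
    · rw [map_inv]
      exact Or.inr (isConj_inv_inv this)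
  · rintro ⟨p, hp, hh⟩
    rw [avoids_direction_iff] at hp
    rw [segTransport_stepTwo _ s p hp] at hh
    have key (c : H) : ∃ γ : Path x₀ (proj (line s p hp 0)),
        ψ (FundamentalGroup.fromPath
          (Path.Homotopic.Quotient.mk ((γ.trans (slopeLoop s p hp)).trans γ.symm))) =
        c * baseHolonomy ψ δ _ _ (slopeLoop s p hp) * c⁻¹ := by
      obtain ⟨c, rfl⟩ := hψ c
      obtain ⟨κ, hκ⟩ := Path.Homotopic.Quotient.mk_surjective c
      refine ⟨κ.symm.trans (δ _), ?_⟩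
      unfold baseHolonomy
      rw [← map_inv, ← map_mul, ← map_mul, FundamentalGroup.mul_def, FundamentalGroup.mul_def,
        FundamentalGroup.inv_def, ← hκ]
      congr 1
      simp only [FundamentalGroup.fromPath, FundamentalGroup.fromArrow, Path.trans_symm,
        Path.symm_symm, Quotient.mk_trans, Quotient.mk_symm, Quotient.trans_assoc]
    rcases hh with hh | hh <;> obtain ⟨c, rfl⟩ := isConj_iff.1 hh <;> obtain ⟨γ, hγ⟩ := key c
    · exact ⟨_, ⟨p, hp, γ, Or.inl rfl⟩, hγ⟩
    · refine ⟨_, ⟨p, hp, γ, Or.inr rfl⟩, ?_⟩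
      rw [map_inv, hγ]
      group

theorem isPathConnected_compl_lattice : IsPathConnected latticeᶜ :=
  (Set.countable_range _).isPathConnected_compl_of_one_lt_rank (by
    rw [← Module.finrank_eq_rank]
    simp)

instance : PathConnectedSpace ConwaySphere := by
  have h := isPathConnected_iff_pathConnectedSpace.1 isPathConnected_compl_lattice
  have hs : Function.Surjective fun x : (latticeᶜ : Set (ℝ × ℝ)) => proj (toPunctured x x.2) := by
    intro a
    obtain ⟨p, rfl⟩ := Quotient.exists_rep a
    exact ⟨⟨p.1, by rintro ⟨v, hv⟩; exact p.2 v hv.symm⟩, rfl⟩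
  exact hs.pathConnectedSpace (continuous_proj.comp (by unfold toPunctured; fun_prop))

/-! ### A winding number -/

/-- The function `cos² (π y) - cos (π x) + i sin (π x) sin (π y)` on the plane. It is invariant
under the half-turns about the lattice points and vanishes only at lattice points. The induced
function on the Conway sphere has winding number `±1` around the two punctures with `x` even and
`0` around the other two; a loop of slope `∞` separates these pairs, a loop of slope `0` does
not. -/
def windingFun (p : ℝ × ℝ) : ℂ :=
  ⟨Real.cos (Real.pi * p.2) ^ 2 - Real.cos (Real.pi * p.1),
    Real.sin (Real.pi * p.1) * Real.sin (Real.pi * p.2)⟩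

theorem continuous_windingFun : Continuous windingFun := by
  have : windingFun = fun p : ℝ × ℝ =>
      ((Real.cos (Real.pi * p.2) ^ 2 - Real.cos (Real.pi * p.1) : ℝ) : ℂ) +
        (Real.sin (Real.pi * p.1) * Real.sin (Real.pi * p.2) : ℝ) * Complex.I := by
    funext p
    exact (Complex.mk_eq_add_mul_I _ _)
  rw [this]
  fun_prop

theorem windingFun_halfTurn (v : ℤ × ℤ) (p : ℝ × ℝ) :
    windingFun (2 * v.1 - p.1, 2 * v.2 - p.2) = windingFun p := by
  have h (k : ℤ) (x : ℝ) : Real.pi * (2 * k - x) = k * (2 * Real.pi) - Real.pi * x := by ring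
  apply Complex.ext <;> simp [windingFun, h, Real.cos_int_mul_two_pi_sub,
    Real.sin_int_mul_two_pi_sub]

theorem sin_pi_mul_eq_zero {x : ℝ} (h : Real.sin (Real.pi * x) = 0) : ∃ m : ℤ, x = m := by
  obtain ⟨m, hm⟩ := Real.sin_eq_zero_iff.1 h
  refine ⟨m, ?_⟩
  have := Real.pi_ne_zero
  apply mul_left_cancel₀ this
  linarith

theorem mem_lattice_of_windingFun {p : ℝ × ℝ} (h : windingFun p = 0) : p ∈ lattice := by
  obtain ⟨x, y⟩ := p
  have hre := congrArg Complex.re h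
  have him := congrArg Complex.im h
  simp only [windingFun, Complex.zero_re, Complex.zero_im] at hre him
  have hx := Real.sin_sq_add_cos_sq (Real.pi * x)
  have hy := Real.sin_sq_add_cos_sq (Real.pi * y)
  have hsx : Real.sin (Real.pi * x) = 0 := by
    rcases mul_eq_zero.1 him with h0 | h0
    · exact h0
    · rw [h0] at hy
      have : Real.cos (Real.pi * x) = 1 := by linarith
      rw [this] at hx
      nlinarith
  have hsy : Real.sin (Real.pi * y) = 0 := by
    have hc : Real.cos (Real.pi * x) = 1 := by
      rw [hsx] at hx
      rw [← sub_eq_zero, ← mul_eq_zero_iff_right (by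
        have := sq_nonneg (Real.cos (Real.pi * y))
        linarith : Real.cos (Real.pi * x) + 1 ≠ 0)]
      linear_combination hx
    nlinarith
  obtain ⟨a, rfl⟩ := sin_pi_mul_eq_zero hsx
  obtain ⟨b, rfl⟩ := sin_pi_mul_eq_zero hsy
  exact ⟨(a, b), rfl⟩

/-- The map from the Conway sphere to `ℂ \ {0}` induced by `windingFun`. -/
def windingMap : C(ConwaySphere, {z : ℂ // z ≠ 0}) where
  toFun := Quotient.lift (fun p : PuncturedPlane =>
      (⟨windingFun p.1, fun h => by
        obtain ⟨v, hv⟩ := mem_lattice_of_windingFun h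
        exact p.2 v hv.symm⟩ : {z : ℂ // z ≠ 0})) (by
    rintro p q ⟨⟨g, hg⟩, rfl⟩
    apply Subtype.ext
    change windingFun (g q).1 = windingFun q.1
    induction hg using Subgroup.closure_induction'' generalizing q with
    | one => rfl
    | mem g hg =>
      obtain ⟨v, rfl⟩ := hg
      exact windingFun_halfTurn v q.1
    | inv_mem g hg =>
      obtain ⟨v, rfl⟩ := hg
      exact windingFun_halfTurn v q.1
    | mul g g' _ _ hg hg' => exact (hg _).trans (hg' _))
  continuous_toFun := by
    apply Continuous.quotient_lift
    exact (continuous_windingFun.comp continuous_subtype_val).subtype_mk _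

/-- The change of the logarithm of `windingMap` along a path. -/
def winding (a b : ConwaySphere) (γ : Path a b) : Multiplicative ℂ :=
  Multiplicative.ofAdd
    (Complex.isCoveringMap_exp.liftPath (windingMap.comp γ.toContinuousMap)
      (Complex.log (windingMap a)) (Subtype.ext (by
        simp [Complex.exp_log (windingMap a).2])) 1 - Complex.log (windingMap a))

/-- The change of the logarithm may be computed with any continuous lift. -/
theorem winding_eq {a b : ConwaySphere} (γ : Path a b) (Γ : C(I, ℂ))
    (hΓ : ∀ t, Complex.exp (Γ t) = windingMap (γ t)) :
    winding a b γ = Multiplicative.ofAdd (Γ 1 - Γ 0) := by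
  let c : ℂ := Complex.log (windingMap a) - Γ 0
  have hc : Complex.exp c = 1 := by
    simp only [c]
    rw [Complex.exp_sub, hΓ, γ.source, Complex.exp_log (windingMap a).2,
      div_self (windingMap a).2]
  have h := (Complex.isCoveringMap_exp.eq_liftPath_iff' (γ := windingMap.comp γ.toContinuousMap)
    (e := Complex.log (windingMap a)) (Subtype.ext (by
        simp [Complex.exp_log (windingMap a).2]))
    (Γ := Γ + ContinuousMap.const I c)).2 ⟨by
      funext t
      apply Subtype.ext
      simp [Complex.exp_add, hc, hΓ], by simp [c]⟩
  unfold winding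
  rw [← h]
  congr 1
  simp only [c, ContinuousMap.add_apply, ContinuousMap.const_apply]
  ring

theorem exists_lift {a b : ConwaySphere} (γ : Path a b) (e : ℂ)
    (he : Complex.exp e = windingMap a) :
    ∃ Γ : C(I, ℂ), Γ 0 = e ∧ ∀ t, Complex.exp (Γ t) = windingMap (γ t) := by
  have h0 : (windingMap.comp γ.toContinuousMap) 0 = ⟨Complex.exp e, Complex.exp_ne_zero e⟩ :=
    Subtype.ext (by simp [he])
  refine ⟨_, Complex.isCoveringMap_exp.liftPath_zero _ e h0, fun t => ?_⟩
  exact congrArg Subtype.val (congrFun (Complex.isCoveringMap_exp.liftPath_lifts _ e h0) t)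

theorem isHolonomy_winding : IsHolonomy winding where
  homotopic {a b γ γ'} h := by
    unfold winding
    congr 2
    exact Complex.isCoveringMap_exp.liftPath_apply_one_eq_of_homotopicRel
      (h.map windingMap) _ _ _
  trans {a b c} γ γ' := by
    obtain ⟨Γ, -, hΓ⟩ := exists_lift γ (Complex.log (windingMap a))
      (Complex.exp_log (windingMap a).2)
    obtain ⟨Γ', h0, hΓ'⟩ := exists_lift γ' (Γ 1) (by rw [hΓ, γ.target])
    let Δ : Path (Γ 0) (Γ' 1) :=
      (⟨Γ, rfl, rfl⟩ : Path (Γ 0) (Γ 1)).trans (⟨Γ', h0, rfl⟩ : Path (Γ 1) (Γ' 1))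
    rw [winding_eq γ Γ hΓ, winding_eq γ' Γ' hΓ', winding_eq (γ.trans γ') Δ.toContinuousMap]
    · rw [← ofAdd_add, h0]
      congr 1
      simp
    · intro t
      change Complex.exp (Δ t) = _
      simp only [Δ, Path.trans_apply]
      split_ifs
      · exact hΓ _
      · exact hΓ' _

/-- A holonomy with commutative values restricts to a homomorphism on the fundamental group. -/
def IsHolonomy.toHom {X H : Type*} [TopologicalSpace X] [CommGroup H]
    {Φ : ∀ a b : X, Path a b → H} (hΦ : IsHolonomy Φ) (x₀ : X) : FundamentalGroup X x₀ →* H :=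
  MonoidHom.mk' (fun g => Quotient.lift (fun γ : Path x₀ x₀ => Φ x₀ x₀ γ)
    (fun _ _ h => hΦ.homotopic h) g) (by
      intro g g'
      induction g using Quotient.inductionOn with | _ γ
      induction g' using Quotient.inductionOn with | _ γ'
      exact hΦ.trans γ' γ)

theorem IsHolonomy.toHom_conj {X H : Type*} [TopologicalSpace X] [CommGroup H]
    {Φ : ∀ a b : X, Path a b → H} (hΦ : IsHolonomy Φ) {x₀ a : X} (γ : Path x₀ a) (α : Path a a) :
    hΦ.toHom x₀ (FundamentalGroup.fromPath
      (Path.Homotopic.Quotient.mk ((γ.trans α).trans γ.symm))) = Φ a a α := by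
  change Φ x₀ x₀ ((γ.trans α).trans γ.symm) = _
  have h1 : Φ a a (Path.refl a) = 1 := by
    have := hΦ.trans (Path.refl a) (Path.refl a)
    rw [Path.refl_trans_refl] at this
    simpa using this
  have h2 : Φ x₀ a γ * Φ a x₀ γ.symm = 1 := by
    rw [← hΦ.trans, ← h1]
    exact (hΦ.homotopic ⟨Path.Homotopy.reflSymmTrans γ⟩).symm
  rw [hΦ.trans, hΦ.trans, mul_comm (Φ a a α), ← mul_assoc, mul_comm (Φ a x₀ _), h2, one_mul]

theorem mem_unorientedConjClass_comm {H : Type*} [CommGroup H] {g h : H} :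
    h ∈ unorientedConjClass g ↔ h = g ∨ h = g⁻¹ := by
  simp [unorientedConjClass, eq_comm]

theorem isCoprime_direction (s : OnePoint ℚ) : IsCoprime (direction s).1 (direction s).2 := by
  induction s using OnePoint.rec with
  | infty => exact isCoprime_one_right
  | coe q =>
    exact Int.isCoprime_iff_gcd_eq_one.2 q.reduced.symm

/-- The winding number of one line of slope `s` determines that of all elements of its class, up to
sign. -/
theorem winding_slopeClass {x₀ : ConwaySphere} {s : OnePoint ℚ} {w : ℂ}
    {p : ℝ × ℝ} (hp : LineAvoidsLattice s p) (Γ : C(I, ℂ))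
    (hΓ : ∀ t, Complex.exp (Γ t) = windingFun (linePoint s p (2 * t))) (hw : Γ 1 - Γ 0 = w)
    {g : FundamentalGroup ConwaySphere x₀} (hg : g ∈ slopeClass x₀ s) :
    isHolonomy_winding.toHom x₀ g = Multiplicative.ofAdd w ∨
      isHolonomy_winding.toHom x₀ g = (Multiplicative.ofAdd w)⁻¹ := by
  have hE := isTransport_segTransport isHolonomy_winding
  have hcls := hE.transportClass_eq (isCoprime_direction s) (avoids_direction_iff.2 hp)
  rw [segTransport_stepTwo _ s p hp, winding_eq (slopeLoop s p hp) Γ hΓ, hw] at hcls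
  rw [← mem_unorientedConjClass_comm, ← hcls]
  obtain ⟨q, hq, γ, hg⟩ := hg
  refine ⟨q, avoids_direction_iff.2 hq, ?_⟩
  rw [mem_unorientedConjClass_comm, segTransport_stepTwo _ s q hq]
  rcases hg with rfl | rfl
  · exact Or.inl (isHolonomy_winding.toHom_conj γ _)
  · right
    rw [map_inv, isHolonomy_winding.toHom_conj]

theorem winding_slopeClass_infty {x₀ : ConwaySphere} {g : FundamentalGroup ConwaySphere x₀}
    (hg : g ∈ slopeClass x₀ OnePoint.infty) : isHolonomy_winding.toHom x₀ g = 1 := by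
  have hp : LineAvoidsLattice OnePoint.infty (1 / 2, 0) := by
    intro t v h
    have := congrArg Prod.fst h
    simp [linePoint, direction] at this
    exact half_ne_int v.1 (by simpa using this)
  have hval (t : ℝ) : windingFun (linePoint OnePoint.infty (1 / 2, 0) (2 * t)) =
      ⟨Real.cos (Real.pi * (2 * t)) ^ 2, Real.sin (Real.pi * (2 * t))⟩ := by
    have e : Real.pi * (1 / 2) = Real.pi / 2 := by ring
    apply Complex.ext <;> simp [windingFun, linePoint, direction, -one_div, e]
  -- the loop stays in the plane slit along the negative real axis
  have hslit (t : ℝ) : windingFun (linePoint OnePoint.infty (1 / 2, 0) (2 * t)) ∈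
      Complex.slitPlane := by
    rw [hval, Complex.mem_slitPlane_iff]
    by_cases h : Real.sin (Real.pi * (2 * t)) = 0
    · left
      have := Real.sin_sq_add_cos_sq (Real.pi * (2 * t))
      rw [h] at this
      simp only
      linarith
    · exact Or.inr h
  have hcont : Continuous fun t : I =>
      Complex.log (windingFun (linePoint OnePoint.infty (1 / 2, 0) (2 * t))) := by
    refine Continuous.clog (continuous_windingFun.comp ?_) fun t => hslit t
    unfold linePoint
    fun_prop
  have := winding_slopeClass hp ⟨_, hcont⟩ (fun t => Complex.exp_log
    (Complex.slitPlane_ne_zero (hslit t))) (w := 0) (by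
      have h0 := hval 0
      have h1 := hval 1
      simp only [mul_zero, mul_one] at h0 h1
      rw [mul_comm, Real.cos_two_pi, Real.sin_two_pi] at h1
      rw [Real.cos_zero, Real.sin_zero] at h0
      simp only [ContinuousMap.coe_mk, Set.Icc.coe_zero, Set.Icc.coe_one, mul_zero, mul_one,
        h0, h1, sub_self]) hg
  simpa using this

theorem winding_slopeClass_zero {x₀ : ConwaySphere} {g : FundamentalGroup ConwaySphere x₀}
    (hg : g ∈ slopeClass x₀ ((0 : ℚ) : OnePoint ℚ)) :
    isHolonomy_winding.toHom x₀ g = Multiplicative.ofAdd (2 * Real.pi * Complex.I) ∨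
      isHolonomy_winding.toHom x₀ g = (Multiplicative.ofAdd (2 * Real.pi * Complex.I))⁻¹ := by
  have hdir : direction ((0 : ℚ) : OnePoint ℚ) = (1, 0) := rfl
  have hp : LineAvoidsLattice ((0 : ℚ) : OnePoint ℚ) (0, 1 / 2) := by
    intro t v h
    have := congrArg Prod.snd h
    simp [linePoint, hdir] at this
    exact half_ne_int v.2 (by simpa using this)
  have := winding_slopeClass hp
    ⟨fun t : I => Real.pi * Complex.I - 2 * Real.pi * t * Complex.I, by fun_prop⟩ (fun t => by
      have e : Real.pi * (1 / 2) = Real.pi / 2 := by ring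
      have e' : Real.pi * Complex.I - 2 * Real.pi * (t : ℝ) * Complex.I =
          ((Real.pi - Real.pi * (2 * t) : ℝ) : ℂ) * Complex.I := by
        push_cast
        ring
      change Complex.exp (Real.pi * Complex.I - 2 * Real.pi * (t : ℝ) * Complex.I) = _
      rw [e']
      apply Complex.ext <;>
        simp [windingFun, linePoint, hdir, -one_div, e, -Complex.ofReal_sub,
          Complex.exp_ofReal_mul_I_re, Complex.exp_ofReal_mul_I_im, Real.cos_pi_sub,
          Real.sin_pi_sub]) (w := -(2 * Real.pi * Complex.I)) (by simp) hg
  rw [ofAdd_neg, inv_inv] at this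
  exact this.symm

/-! ### Slopes of primitive vectors -/

/-- The slope of a nonzero integer vector, with value `∞` also at the zero vector. -/
def slopeOf (d : ℤ × ℤ) : OnePoint ℚ :=
  if d.1 = 0 then OnePoint.infty else ((d.2 / d.1 : ℚ) : OnePoint ℚ)

theorem slopeOf_direction (s : OnePoint ℚ) : slopeOf (direction s) = s := by
  induction s using OnePoint.rec with
  | infty => rfl
  | coe q =>
    change (if (q.den : ℤ) = 0 then OnePoint.infty
      else (((q.num : ℚ) / ((q.den : ℤ) : ℚ) : ℚ) : OnePoint ℚ)) = _
    rw [if_neg (by simp), Int.cast_natCast, Rat.num_div_den]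

theorem direction_slopeOf {d : ℤ × ℤ} (hd : IsCoprime d.1 d.2) :
    direction (slopeOf d) = d ∨ direction (slopeOf d) = -d := by
  obtain ⟨b, a⟩ := d
  simp only at hd
  have pos {b a : ℤ} (hd : IsCoprime b a) (hb : 0 < b) :
      direction (((a / b : ℚ)) : OnePoint ℚ) = (b, a) := by
    have hcop : Nat.Coprime a.natAbs b.natAbs := (Int.isCoprime_iff_gcd_eq_one.1 hd.symm)
    exact Prod.ext (Rat.den_div_eq_of_coprime hb hcop) (Rat.num_div_eq_of_coprime hb hcop)
  unfold slopeOf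
  rcases lt_trichotomy b 0 with hb | rfl | hb
  · right
    rw [if_neg hb.ne, ← neg_div_neg_eq]
    have := pos hd.neg_neg (neg_pos.2 hb)
    push_cast at this
    exact this
  · rw [if_pos rfl]
    rw [isCoprime_zero_left, Int.isUnit_iff] at hd
    rcases hd with rfl | rfl
    · exact Or.inl rfl
    · exact Or.inr rfl
  · exact Or.inl (by rw [if_neg hb.ne']; exact pos hd hb)

theorem reflection_smul_slopeOf (k : ℤ) (d : ℤ × ℤ) :
    reflection k • slopeOf d = slopeOf (d.1, 2 * k * d.1 - d.2) := by
  unfold slopeOf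
  by_cases h : d.1 = 0
  · rw [if_pos h, if_pos h, reflection_smul_infty]
  · have h' : (d.1 : ℚ) ≠ 0 := by exact_mod_cast h
    rw [if_neg h, if_neg h, reflection_smul_coe]
    congr 1
    push_cast
    field_simp

theorem parabolicZero_smul_slopeOf (m : ℤ) {d : ℤ × ℤ} (hd : IsCoprime d.1 d.2) :
    parabolicZero m • slopeOf d = slopeOf (d.1 + m * d.2, d.2) := by
  unfold slopeOf
  by_cases h : d.1 = 0
  · have h2 : (d.2 : ℚ) ≠ 0 := by
      intro h2
      norm_cast at h2
      rw [h, h2] at hd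
      exact not_isCoprime_zero_zero hd
    rw [if_pos h, parabolicZero_smul_infty, h]
    by_cases hm : m = 0
    · simp [hm]
    · have hm' : (m : ℚ) ≠ 0 := by exact_mod_cast hm
      have h2' : d.2 ≠ 0 := by exact_mod_cast h2
      rw [if_neg hm', if_neg (by simp [hm, h2'])]
      congr 1
      push_cast
      field_simp
      simp
  · have h' : (d.1 : ℚ) ≠ 0 := by exact_mod_cast h
    have e : (m : ℚ) * (d.2 / d.1) + 1 = (d.1 + m * d.2 : ℤ) / d.1 := by
      push_cast
      field_simp
      ring
    rw [if_neg h, parabolicZero_smul_coe, e]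
    by_cases hz : d.1 + m * d.2 = 0
    · simp [hz]
    · have hz' : ((d.1 + m * d.2 : ℤ) : ℚ) ≠ 0 := by exact_mod_cast hz
      rw [if_neg (div_ne_zero hz' h'), if_neg hz, div_div_div_cancel_right₀ h']

theorem exists_avoids {d : ℤ × ℤ} (hd : IsCoprime d.1 d.2) : ∃ p, Avoids d p := by
  obtain ⟨a, b, h⟩ := hd
  refine ⟨(-(b / 2), a / 2), avoids_of_ne fun z => ?_⟩
  have h' : (a * d.1 + b * d.2 : ℝ) = 1 := by exact_mod_cast h
  convert half_ne_int z using 1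
  linear_combination h' / 2

/-! ### Invariance of the class under `Γ(0; n)` -/

namespace IsTransport

variable {H : Type*} [Group H] {E : ℝ × ℝ → ℝ × ℝ → H}

theorem transportClass_direction_slopeOf (hE : IsTransport E) {d : ℤ × ℤ}
    (hd : IsCoprime d.1 d.2) : transportClass E (direction (slopeOf d)) = transportClass E d := by
  obtain ⟨p, hp⟩ := exists_avoids hd
  rcases direction_slopeOf hd with h | h
  · rw [h]
  · exact hE.transportClass_neg hd h hp

/-- `transportClass_reflection` without the sign condition on the direction. -/
theorem transportClass_mirror (hE : IsTransport E)
    (hv : ∀ x : ℝ, (∀ m : ℤ, x ≠ m) → ∀ y, E (x, y) (x, y + 2) = 1)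
    {d : ℤ × ℤ} (hd : IsCoprime d.1 d.2) (k : ℤ) :
    transportClass E (d.1, 2 * k * d.1 - d.2) = transportClass E d := by
  obtain ⟨p, hp⟩ := exists_avoids hd
  have hd' : IsCoprime d.1 (2 * k * d.1 - d.2) := by
    rw [show 2 * k * d.1 - d.2 = -d.2 + d.1 * (2 * k) by ring]
    exact hd.neg_right.add_mul_left_right _
  obtain ⟨q, hq⟩ := exists_avoids (d := (d.1, 2 * k * d.1 - d.2)) hd'
  rcases lt_trichotomy d.1 0 with h | h | h
  · rw [← hE.transportClass_neg hd rfl hp,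
      ← hE.transportClass_neg (d := (d.1, 2 * k * d.1 - d.2)) hd' rfl hq]
    have := hE.transportClass_reflection hv (neg_pos.2 h) hd.neg_neg k
    have e : (-(d.1, 2 * k * d.1 - d.2) : ℤ × ℤ) = (-d.1, 2 * k * -d.1 - -d.2) := by
      ext <;> simp
      ring
    rw [e]
    exact this
  · refine hE.transportClass_neg hd ?_ hp
    ext <;> simp [h]
  · exact hE.transportClass_reflection hv h hd k

/-- `transportClass_shear` with the coordinates exchanged and without the sign condition. -/
theorem transportClass_horizontal_shear (hE : IsTransport E) {r : ℤ}
    (hr : ∀ y : ℝ, (∀ m : ℤ, y ≠ m) → ∀ x, E (x, y) (x + 2, y) ^ r = 1)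
    {d : ℤ × ℤ} (hd : IsCoprime d.1 d.2) :
    transportClass E (d.1 + 2 * r * d.2, d.2) = transportClass E d := by
  have pos {d : ℤ × ℤ} (hd : IsCoprime d.1 d.2) (h : 0 < d.2) :
      transportClass E (d.1 + 2 * r * d.2, d.2) = transportClass E d := by
    have := hE.swap.transportClass_shear hr h hd.symm
    rwa [← transportClass_swap, ← transportClass_swap E d]
  rcases lt_trichotomy d.2 0 with h | h | h
  -- reverse the direction to make the second coordinate positive
  · obtain ⟨p, hp⟩ := exists_avoids hd
    have hd' : IsCoprime (d.1 + 2 * r * d.2) d.2 := by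
      rw [show d.1 + 2 * r * d.2 = d.1 + d.2 * (2 * r) by ring]
      exact hd.add_mul_left_left _
    obtain ⟨q, hq⟩ := exists_avoids (d := (d.1 + 2 * r * d.2, d.2)) hd'
    rw [← hE.transportClass_neg hd rfl hp, ← pos (d := -d) hd.neg_neg (by simpa using h)]
    refine (hE.transportClass_neg (d := (d.1 + 2 * r * d.2, d.2)) hd' ?_ hq).symm
    ext <;> simp
    ring
  · rw [h, mul_zero, add_zero, ← h]
  · exact pos hd h

theorem transportClass_gam_smul (hE : IsTransport E) {n : ℕ}
    (hv : ∀ x : ℝ, (∀ m : ℤ, x ≠ m) → ∀ y, E (x, y) (x, y + 2) = 1)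
    (hh : ∀ y : ℝ, (∀ m : ℤ, y ≠ m) → ∀ x, E (x, y) (x + 2, y) ^ (n : ℤ) = 1)
    {g : GL (Fin 2) ℚ} (hg : g ∈ Gam n) (s : OnePoint ℚ) :
    transportClass E (direction (g • s)) = transportClass E (direction s) := by
  have gen (g : GL (Fin 2) ℚ) (hg : g ∈ Set.range reflection ∪ {parabolicZero (2 * n)})
      (s : OnePoint ℚ) :
      transportClass E (direction (g • s)) = transportClass E (direction s) := by
    have hd := isCoprime_direction s
    nth_rewrite 1 [← slopeOf_direction s]
    set d := direction s
    rcases hg with ⟨k, rfl⟩ | rfl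
    · have hd' : IsCoprime d.1 (2 * k * d.1 - d.2) := by
        rw [show 2 * k * d.1 - d.2 = -d.2 + d.1 * (2 * k) by ring]
        exact hd.neg_right.add_mul_left_right _
      rw [reflection_smul_slopeOf, hE.transportClass_direction_slopeOf hd',
        hE.transportClass_mirror hv hd]
    · have hd' : IsCoprime (d.1 + 2 * n * d.2) d.2 := by
        rw [show d.1 + 2 * n * d.2 = d.1 + d.2 * (2 * n) by ring]
        exact hd.add_mul_left_left _
      rw [parabolicZero_smul_slopeOf _ hd, hE.transportClass_direction_slopeOf hd',
        hE.transportClass_horizontal_shear hh hd]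
  induction hg using Subgroup.closure_induction'' generalizing s with
  | one => rw [one_smul]
  | mem g hg => exact gen g hg s
  | inv_mem g hg => rw [← gen g hg, smul_inv_smul]
  | mul g g' _ _ hg hg' => rw [mul_smul, hg, hg']

end IsTransport

/-! ### The Heckoid group -/

theorem eq_one_of_mem_heckeClass_infty (r : ℚ) (n : ℕ) (x₀ : ConwaySphere) :
    ∀ g ∈ heckeClass r n x₀ OnePoint.infty, g = 1 := by
  rintro _ ⟨g, hg, rfl⟩
  exact (QuotientGroup.eq_one_iff g).2 (Subgroup.subset_normalClosure (Or.inl hg))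

theorem pow_eq_one_of_mem_heckeClass (r : ℚ) (n : ℕ) (x₀ : ConwaySphere) :
    ∀ g ∈ heckeClass r n x₀ (r : OnePoint ℚ), g ^ n = 1 := by
  rintro _ ⟨g, hg, rfl⟩
  rw [← map_pow]
  exact (QuotientGroup.eq_one_iff (g ^ n)).2
    (Subgroup.subset_normalClosure (Or.inr ⟨g, hg, rfl⟩))

/-- The winding number of `α_0` is `±1`, while the relators of the Heckoid group have winding
number divisible by `n`. -/
theorem ne_one_of_mem_heckeClass_zero {n : ℕ} (hn : 2 ≤ n) (x₀ : ConwaySphere) :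
    ∀ g ∈ heckeClass 0 n x₀ ((0 : ℚ) : OnePoint ℚ), g ≠ 1 := by
  rintro _ ⟨g, hg, rfl⟩ h1
  let χ := isHolonomy_winding.toHom x₀
  set t : Multiplicative ℂ := Multiplicative.ofAdd (2 * Real.pi * Complex.I) with ht
  have hle : relators 0 n x₀ ≤ (Subgroup.zpowers (t ^ n)).comap χ := by
    refine Subgroup.normalClosure_le_normal ?_
    rintro _ (hu | ⟨u, hu, rfl⟩)
    · rw [SetLike.mem_coe, Subgroup.mem_comap]
      change isHolonomy_winding.toHom x₀ _ ∈ _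
      rw [winding_slopeClass_infty hu]
      exact one_mem _
    · simp only [SetLike.mem_coe, Subgroup.mem_comap, map_pow]
      change isHolonomy_winding.toHom x₀ _ ^ n ∈ _
      rcases winding_slopeClass_zero hu with h | h <;> rw [h]
      · exact Subgroup.mem_zpowers _
      · rw [inv_pow]
        exact inv_mem (Subgroup.mem_zpowers _)
  have htne : (2 * Real.pi * Complex.I : ℂ) ≠ 0 := Complex.two_pi_I_ne_zero
  have hmem : t ∈ Subgroup.zpowers (t ^ n) := by
    have h2 : χ g ∈ Subgroup.zpowers (t ^ n) := hle ((QuotientGroup.eq_one_iff g).1 h1)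
    rcases winding_slopeClass_zero hg with h | h <;> simp only [χ, h] at h2
    · exact h2
    · exact inv_mem_iff.1 h2
  obtain ⟨k, hk⟩ := hmem
  have hk' : (k * n : ℂ) * (2 * Real.pi * Complex.I) = 1 * (2 * Real.pi * Complex.I) := by
    have hk1 : k • n • (2 * Real.pi * Complex.I : ℂ) = 2 * Real.pi * Complex.I :=
      congrArg Multiplicative.toAdd hk
    rw [zsmul_eq_mul, nsmul_eq_mul] at hk1
    rw [one_mul, mul_assoc]
    exact hk1
  have hk2 := mul_right_cancel₀ htne hk'
  norm_cast at hk2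
  have : (n : ℤ) ∣ 1 := ⟨k, by rw [mul_comm]; exact hk2.symm⟩
  have := Int.le_of_dvd one_pos this
  omega

/-- The class in the Heckoid group of the loop of slope `s` is one conjugacy class up to
inversion. -/
theorem exists_heckeClass_eq (r : ℚ) (n : ℕ) (x₀ : ConwaySphere) (s : OnePoint ℚ) :
    ∃ g : Hecke r n x₀, heckeClass r n x₀ s = unorientedConjClass g := by
  have hψ := QuotientGroup.mk'_surjective (relators r n x₀)
  let δ := fun a => PathConnectedSpace.somePath x₀ a
  have hE := isTransport_segTransport 
    (isHolonomy_baseHolonomy (QuotientGroup.mk' (relators r n x₀)) δ)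
  obtain ⟨p, hp⟩ := exists_avoids (isCoprime_direction s)
  exact ⟨_, (image_slopeClass _ hψ δ s).trans (hE.transportClass_eq (isCoprime_direction s) hp)⟩

theorem heckeClass_gam_smul (n : ℕ) (x₀ : ConwaySphere) {g : GL (Fin 2) ℚ} (hg : g ∈ Gam n)
    (s : OnePoint ℚ) : heckeClass 0 n x₀ (g • s) = heckeClass 0 n x₀ s := by
  have hψ := QuotientGroup.mk'_surjective (relators 0 n x₀)
  let δ := fun a => PathConnectedSpace.somePath x₀ a
  have hE := isTransport_segTransport
    (isHolonomy_baseHolonomy (QuotientGroup.mk' (relators 0 n x₀)) δ)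
  have hcls := image_slopeClass (QuotientGroup.mk' (relators 0 n x₀)) hψ δ
  refine (hcls _).trans ((hE.transportClass_gam_smul ?_ ?_ hg s).trans (hcls s).symm)
  · intro x hx y
    apply eq_one_of_mem_heckeClass_infty 0 n x₀
    rw [heckeClass, hcls]
    refine ⟨(x, y), avoids_of_ne fun z => ?_, ?_⟩
    · have := hx (-z)
      push_cast at this
      simp only [direction, OnePoint.elim_infty, Int.cast_zero, zero_mul, Int.cast_one, one_mul,
        zero_sub]
      exact fun h => this (by linarith)
    · convert mem_unorientedConjClass_self _ using 2
      ext <;> simp [stepTwo, direction]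
  · intro y hy x
    rw [zpow_natCast]
    apply pow_eq_one_of_mem_heckeClass 0 n x₀
    rw [heckeClass, hcls]
    have hdir : direction ((0 : ℚ) : OnePoint ℚ) = (1, 0) := rfl
    rw [hdir]
    refine ⟨(x, y), avoids_of_ne fun z => ?_, ?_⟩
    · simpa using hy z
    · convert mem_unorientedConjClass_self _ using 2
      ext <;> simp [stepTwo]

end Heckoid

end

theorem theorem2p1 (n : ℕ) (hn : 2 ≤ n) (s : OnePoint ℚ) :
    (∃! s₀ : OnePoint ℚ,
      s₀ ∈ Heckoid.fundamentalSlopes n ∧ s ∈ MulAction.orbit (Heckoid.Gam n) s₀) ∧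
    ∀ s₀ : OnePoint ℚ,
      s₀ ∈ Heckoid.fundamentalSlopes n → s ∈ MulAction.orbit (Heckoid.Gam n) s₀ →
      ∀ x₀ : Heckoid.ConwaySphere,
        (∃ g : Heckoid.Hecke 0 n x₀,
          Heckoid.heckeClass 0 n x₀ s = Heckoid.unorientedConjClass g ∧
          Heckoid.heckeClass 0 n x₀ s₀ = Heckoid.unorientedConjClass g) ∧
        (s₀ = OnePoint.infty → Heckoid.heckeClass 0 n x₀ s = {1}) ∧
        (s₀ = ((0 : ℚ) : OnePoint ℚ) →
          ∀ g ∈ Heckoid.heckeClass 0 n x₀ s, g ≠ 1 ∧ IsOfFinOrder g) := by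
  constructor
  · obtain ⟨s₀, h0, h1⟩ := Heckoid.exists_fundamental hn s
    refine ⟨s₀, ⟨h0, h1⟩, fun t ⟨ht0, ht1⟩ => Heckoid.eq_of_mem_orbit hn h0 ht0 ?_⟩
    rw [← MulAction.orbit_eq_iff] at h1 ht1 ⊢
    exact ht1.symm.trans h1
  · intro s₀ h0 h1 x₀
    have he : Heckoid.heckeClass 0 n x₀ s = Heckoid.heckeClass 0 n x₀ s₀ := by
      obtain ⟨⟨g, hg⟩, rfl⟩ := h1
      exact Heckoid.heckeClass_gam_smul n x₀ hg s₀
    obtain ⟨g, hg⟩ := Heckoid.exists_heckeClass_eq 0 n x₀ s₀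
    refine ⟨⟨g, he.trans hg, hg⟩, ?_, ?_⟩
    · rintro rfl
      have hg1 : g = 1 := Heckoid.eq_one_of_mem_heckeClass_infty 0 n x₀ g
        (hg ▸ Heckoid.mem_unorientedConjClass_self g)
      rw [he, hg, hg1, Heckoid.unorientedConjClass_one]
    · rintro rfl u hu
      rw [he] at hu
      exact ⟨Heckoid.ne_one_of_mem_heckeClass_zero hn x₀ u hu,
        isOfFinOrder_iff_pow_eq_one.2
          ⟨n, by omega, Heckoid.pow_eq_one_of_mem_heckeClass 0 n x₀ u hu⟩⟩
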